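/- Let $\Omega\subseteq\mathbb{R}^n\times\mathbb{R}^2$ be open, let $f:\Omega\to\mathbb{R}^n$ be smooth, and consider, in local coordinates, the two-input system $\dot x=f(x,u)$ with $n$ states. Write a jet as $p=(x,u,\dot u,\ddot u,\ldots)$ (the space of jets has the product topology). For a smooth function $\varphi$ of $(x,u)$, let $\varphi^{(k)}$ be its $k$-th time derivative along the system, a function of $(x,u,\dot u,\ldots,u^{(k)})$. A function $\varphi=(\varphi_1,\varphi_2)$ of $(x,u)$ is an $(x,u)$-flat output around a jet $p$ if $\varphi$ is smooth near $(x,u)$ and, for some $r$ and some smooth $F_x,F_u$, the identities $x=F_x(\varphi,\dot\varphi,\ldots,\varphi^{(r-1)})$ and $u=F_u(\varphi,\dot\varphi,\ldots,\varphi^{(r)})$ hold on a neighbourhood of $p$. Let $W$ be an open set of jets with $(x,u)\in\Omega$, and let $\varphi=\varphi(x,u)$ be an $(x,u)$-flat output around every jet of $W$. Then for generic jets of $W$ (all jets of an open dense subset of $W$) there is, near $(x,u)$, an invertible smooth input transformation $\bar u=g(x,u)$ with inverse $u=h(x,\bar u)$ such that the system obtained by prolonging $\bar u_1$ exactly $n$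 times, $$\dot x=f\big(x,h(x,\bar u_1,\bar u_2)\big),\quad \dot{\bar u}_1=\bar u_{1,1},\quad \dot{\bar u}_{1,1}=\bar u_{1,2},\ \ldots,\quad \dot{\bar u}_{1,n-1}=\bar u_{1,n},$$ with state $(x,\bar u_1,\bar u_{1,1},\ldots,\bar u_{1,n-1})$ and input $(\bar u_{1,n},\bar u_2)$ (for $n=0$ the system is not prolonged), is static feedback linearizable around the point that the jet determines, i.e. the point with $\bar u_{1,k}=\bar u_1^{(k)}$: there a smooth invertible state transformation $z=\Phi_x$ (of the state) and input transformation $v=\Phi_u$ (of the state and the input) takes it to the Brunovský normal form $\dot z_{j,i}=z_{j,i+1}$ for $1\le i<\rho_j$, $\dot z_{j,\rho_j}=v_j$, $j=1,2$, with $\rho_1,\rho_2\ge 0$ and $\rho_1+\rho_2=2n$. Moreover $\varphi$ is a linearizing output of the prolonged system: the transformation can be chosen such that $\varphi_j=z_{j,1}$ (and $\varphi_j=v_j$ if $\rho_j=0$). Equivalently, the flat parameterization of the prolonged system with respect to $\varphi$, which expresses its state and input through $\varphi_1,\ldots,\varphi_1^{(\rho_1)},\varphi_2,\ldots,\varphi_2^{(\rho_2)}$,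 is a local diffeomorphism. -/

import Mathlib

open Filter Topology
open scoped ContDiff Manifold

noncomputable section

/-- Values of the two-dimensional input. -/
abbrev Input := Fin 2 → ℝ

/-- Infinite jets `(x, u, u', u'', …)`: `p.1` is the state and `p.2 k` is the `k`-th time
derivative of the input. The topology is the product topology, so a neighbourhood restricts only
finitely many derivatives of the input. -/
abbrev Jet (E : Type*) := E × (ℕ → Input)

section Basic

variable {E F : Type*} [NormedAddCommGroup E] [NormedSpace ℝ E]
  [NormedAddCommGroup F] [NormedSpace ℝ F]

/-- `g` is smooth on a neighbourhood of `a`. -/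
def SmoothNear (g : E → F) (a : E) : Prop :=
  ∀ᶠ b in 𝓝 a, ContDiffAt ℝ ∞ g b

/-- The Cartan field of `x' = f (x, u)`, that is `f ∂_x + u' ∂_u + u'' ∂_{u'} + …`. -/
def cartanField (f : E × Input → E) (p : Jet E) : Jet E :=
  (f (p.1, p.2 0), fun k => p.2 (k + 1))

/-- Total time derivative of a function on jets along `x' = f (x, u)`. -/
def totalDeriv (f : E × Input → E) (g : Jet E → F) (p : Jet E) : F :=
  lineDeriv ℝ g p (cartanField f p)

/-- The `k`-th time derivative, along `x' = f (x, u)`, of a function `φ` of `(x, u)`;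
it is a function of `(x, u, u', …, u^(k))`. -/
def outputDeriv (f : E × Input → E) (φ : E × Input → F) (k : ℕ) : Jet E → F :=
  (totalDeriv f)^[k] (fun p => φ (p.1, p.2 0))

/-- `y = φ (x, u)` is an `(x, u)`-flat output of `x' = f (x, u)` around the jet `p`: near `p`,
`x` is a smooth function of `φ, …, φ^(r-1)` and `u` is a smooth function of `φ, …, φ^(r)`,
for some `r`. -/
def IsFlatOutputAt (f : E × Input → E) (φ : E × Input → Fin 2 → ℝ) (p : Jet E) : Prop :=
  SmoothNear φ (p.1, p.2 0) ∧
  ∃ (r : ℕ) (Fx : (Fin r → Fin 2 → ℝ) → E) (Fu : (Fin (r + 1) → Fin 2 → ℝ) → Input),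
    SmoothNear Fx (fun i => outputDeriv f φ i p) ∧
    SmoothNear Fu (fun i => outputDeriv f φ i p) ∧
    ∀ᶠ q in 𝓝 p,
      q.1 = Fx (fun i => outputDeriv f φ i q) ∧
      q.2 0 = Fu (fun i => outputDeriv f φ i q)

/-- `ū = g (x, u)` is an invertible input transformation around `a = (x, u)`, with inverse
`u = h (x, ū)`. The last clause determines `h` near `(x, ū)`, because
`(x, u) ↦ (x, g (x, u))` is a local diffeomorphism. -/
def IsInputTransformationAt (g h : E × Input → Input) (a : E × Input) : Prop :=
  IsLocalDiffeomorphAt 𝓘(ℝ, E × Input) 𝓘(ℝ, E × Input) ∞ (fun b => (b.1, g b)) a ∧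
  ∀ᶠ b in 𝓝 a, h (b.1, g b) = b.2

/-- The system `x' = f (x, h (x, ū))` with the new input `ū`. -/
def transformInput (f : E × Input → E) (h : E × Input → Input) : E × Input → E :=
  fun b => f (b.1, h b)

/-- `(ū₁, …, ū₁^(k))` as a function of the state `(x, ū₁, …, ū₁^(k-1))` and the input
`(ū₁^(k), ū₂)` of a `k`-fold prolonged system. -/
def prolongedInput {k : ℕ} (q : (E × (Fin k → ℝ)) × Input) : Fin (k + 1) → ℝ :=
  Fin.snoc q.1.2 (q.2 0)

/-- The point `(x, (ū₁, ū₂))` below a point of the `k`-fold prolonged system. -/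
def prolongedBase {k : ℕ} (q : (E × (Fin k → ℝ)) × Input) : E × Input :=
  (q.1.1, ![prolongedInput q 0, q.2 1])

/-- The `k`-fold prolongation of the first input of `x' = f (x, ū₁, ū₂)`: the state is
`(x, ū₁, …, ū₁^(k-1))` and the input is `(ū₁^(k), ū₂)`. -/
def prolong (f : E × Input → E) (k : ℕ) :
    (E × (Fin k → ℝ)) × Input → E × (Fin k → ℝ) :=
  fun q => (f (prolongedBase q), fun i => prolongedInput q i.succ)

/-- The point of the `k`-fold prolonged system, in the new input `ū = g (x, u)`, that is given by
a jet of the original system: `((x, ū₁, …, ū₁^(k-1)), (ū₁^(k), ū₂))`. -/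
def prolongedPoint (f : E × Input → E) (g : E × Input → Input) (k : ℕ) (p : Jet E) :
    (E × (Fin k → ℝ)) × Input :=
  ((p.1, fun i => outputDeriv f (fun b => g b 0) i p),
    ![outputDeriv f (fun b => g b 0) k p, g (p.1, p.2 0) 1])

/-- The `j`-th chain `(z_{j,1}, …, z_{j,ρ_j}, v_j)` of Brunovský variables, where `z = Φx x` is the
new state and `v = Φu (x, u)` is the new input. -/
def brunovskyChain {ρ : Fin 2 → ℕ} (Φx : E → (j : Fin 2) → Fin (ρ j) → ℝ)
    (Φu : E × Input → Input) (q : E × Input) (j : Fin 2) : Fin (ρ j + 1) → ℝ :=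
  Fin.snoc (Φx q.1 j) (Φu q j)

/-- Around `a`, the state transformation `z = Φx x` and the input transformation `v = Φu (x, u)`
are invertible and take `x' = f (x, u)` to the Brunovský normal form with two chains of
integrators of lengths `ρ 0` and `ρ 1`: `z_{j,i}' = z_{j,i+1}` for `i < ρ_j` and
`z_{j,ρ_j}' = v_j`. A length may be zero, as for the system `x' = u₁`. -/
def IsBrunovskyTransformationAt (f : E × Input → E) (ρ : Fin 2 → ℕ)
    (Φx : E → (j : Fin 2) → Fin (ρ j) → ℝ) (Φu : E × Input → Input) (a : E × Input) : Prop :=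
  ρ 0 + ρ 1 = Module.finrank ℝ E ∧
  IsLocalDiffeomorphAt 𝓘(ℝ, E) 𝓘(ℝ, (j : Fin 2) → Fin (ρ j) → ℝ) ∞ Φx a.1 ∧
  IsLocalDiffeomorphAt 𝓘(ℝ, E × Input) 𝓘(ℝ, ((j : Fin 2) → Fin (ρ j) → ℝ) × Input) ∞
    (fun q => (Φx q.1, Φu q)) a ∧
  ∀ᶠ q in 𝓝 a, ∀ (j : Fin 2) (i : Fin (ρ j)),
    fderiv ℝ Φx q.1 (f q) j i = brunovskyChain Φx Φu q j i.succ

/-- `x' = f (x, u)` is static feedback linearizable around `a = (x, u)`. -/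
def IsStaticFeedbackLinearizableAt (f : E × Input → E) (a : E × Input) : Prop :=
  ∃ (ρ : Fin 2 → ℕ) (Φx : E → (j : Fin 2) → Fin (ρ j) → ℝ) (Φu : E × Input → Input),
    IsBrunovskyTransformationAt f ρ Φx Φu a

/-- `y` is a linearizing output of `x' = f (x, u)` around `a = (x, u)`: its components are the
first variables of the two chains of a Brunovský normal form. The chains then consist of
`y_j, y_j', …, y_j^(ρ_j)`, so the local inverse of `(Φx, Φu)`, which expresses `(x, u)` through
them, is the flat parameterization with respect to `y`, and it is a local diffeomorphism. -/
def IsLinearizingOutputAt (f : E × Input → E) (y : E × Input → Fin 2 → ℝ)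
    (a : E × Input) : Prop :=
  ∃ (ρ : Fin 2 → ℕ) (Φx : E → (j : Fin 2) → Fin (ρ j) → ℝ) (Φu : E × Input → Input),
    IsBrunovskyTransformationAt f ρ Φx Φu a ∧
    ∀ᶠ q in 𝓝 a, ∀ j : Fin 2, y q j = brunovskyChain Φx Φu q j 0

end Basic

end

/-!
A normal form for two-input systems with an `(x, u)`-flat output.

Take the lowest order `k` at which a derivative of some component `φ j` depends on the input, near
a suitable jet, and use `φ j^(k)`, which is then a function of `(x, u)`, as the first new input
`ū₁`; a coordinate of `u` serves as `ū₂`. Let `φ j'` be the other component and let `s` be the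
lowest order at which one of its derivatives, in the new coordinates, depends on `ū₂`. Such `k` and
`s` exist, because flatness recovers the input from the output. Both are minimal over an open set of
jets, so that "does not depend on" holds on a neighbourhood; this is where genericity enters.

For `K ≥ s`, the system with `ū₁` prolonged `K` times has, with respect to the output `φ`, the vector
relative degree `(k + K, s)`: `φ j^(k+K) = ū₁^(K)` is one input, and `φ j'^(s)` depends on the other
one (`IsNormalizedAt.hasRelativeDegreeAt`). The value of `s` follows from two estimates.

* `k + s ≤ n`. The differentials of the functions in the two chains of a system with a vector
  relative degree are linearly independent, as their values on the iterated Lie brackets of the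
  drift with the input directions form a block triangular matrix
  (`HasRelativeDegreeAt.linearIndependent`). For the `s`-fold prolongation this gives
  `(k + s) + s ≤ n + s`.
* `n ≤ k + s`. If the differentials of `φ j^(i)`, `i < k`, and `φ j'^(i)`, `i < s`, had a common zero
  `ξ ≠ 0` in the state directions, then `ξ` would extend to a tangent vector of the space of jets
  on which the differentials of all derivatives of the output up to any given order vanish: the
  components along the derivatives of `ū₁` are zero, and those along the derivatives of `ū₂` are
  determined one after the other. This contradicts flatness, as `x` is a function of the output and
  its derivatives (`IsNormalizedAt.finrank_le`).

Hence `s = n - k ≤ n`, and for `K = n` the relative degrees `k + n` and `n - k` add up to the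
dimension `2n` of the prolonged state. The two chains `φ j, …, φ j^(k+n)` and `φ j', …, φ j'^(n-k)`
are then local coordinates that take the system to Brunovský normal form
(`HasRelativeDegreeAt.isBrunovskyTransformationAt`).

Jets have infinitely many coordinates, but the functions of jets that occur depend smoothly on
finitely many of them (`JetSmoothAt`), which reduces their calculus to that of normed spaces. The
passage to the new input is a local homeomorphism `jetMap` of jets that commutes with the time
derivatives (`outputDeriv_jetMap`).
-/

noncomputable section

/-! ### Functions that are smooth near a point -/

section SmoothNear

variable {E F G : Type*} [NormedAddCommGroup E] [NormedSpace ℝ E]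
  [NormedAddCommGroup F] [NormedSpace ℝ F] [NormedAddCommGroup G] [NormedSpace ℝ G]

theorem SmoothNear.contDiffAt {g : E → F} {a : E} (h : SmoothNear g a) : ContDiffAt ℝ ∞ g a :=
  h.self_of_nhds

theorem SmoothNear.differentiableAt {g : E → F} {a : E} (h : SmoothNear g a) :
    DifferentiableAt ℝ g a :=
  h.contDiffAt.differentiableAt (by simp)

theorem SmoothNear.continuousAt {g : E → F} {a : E} (h : SmoothNear g a) : ContinuousAt g a :=
  h.contDiffAt.continuousAt

theorem SmoothNear.eventually {g : E → F} {a : E} (h : SmoothNear g a) :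
    ∀ᶠ b in 𝓝 a, SmoothNear g b :=
  eventually_eventually_nhds.2 h

theorem ContDiff.smoothNear {g : E → F} (h : ContDiff ℝ ∞ g) (a : E) : SmoothNear g a :=
  Eventually.of_forall fun _ => h.contDiffAt

theorem ContDiffOn.smoothNear {g : E → F} {s : Set E} (h : ContDiffOn ℝ ∞ g s) (hs : IsOpen s)
    {a : E} (ha : a ∈ s) : SmoothNear g a := by
  filter_upwards [hs.mem_nhds ha] with b hb
  exact h.contDiffAt (hs.mem_nhds hb)

theorem SmoothNear.comp {g : F → G} {k : E → F} {a : E} (hg : SmoothNear g (k a))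
    (hk : SmoothNear k a) : SmoothNear (fun b => g (k b)) a := by
  filter_upwards [hk, hk.continuousAt.eventually hg] with b hb hb'
  exact hb'.comp b hb

theorem SmoothNear.prodMk {g : E → F} {k : E → G} {a : E} (hg : SmoothNear g a)
    (hk : SmoothNear k a) : SmoothNear (fun b => (g b, k b)) a := by
  filter_upwards [hg, hk] with b hb hb'
  exact hb.prodMk hb'

theorem SmoothNear.pi {ι : Type*} [Fintype ι] {H : ι → Type*} [∀ i, NormedAddCommGroup (H i)]
    [∀ i, NormedSpace ℝ (H i)] {g : (i : ι) → E → H i} {a : E} (hg : ∀ i, SmoothNear (g i) a) :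
    SmoothNear (fun b i => g i b) a := by
  filter_upwards [eventually_all.2 hg] with b hb
  exact contDiffAt_pi.2 hb

theorem SmoothNear.fderiv {g : E → F} {a : E} (hg : SmoothNear g a) :
    SmoothNear (fderiv ℝ g) a := by
  filter_upwards [hg] with b hb
  exact hb.fderiv_right (by simp)

theorem SmoothNear.clm_apply {g : E → F →L[ℝ] G} {k : E → F} {a : E} (hg : SmoothNear g a)
    (hk : SmoothNear k a) : SmoothNear (fun b => g b (k b)) a := by
  filter_upwards [hg, hk] with b hb hb'
  exact hb.clm_apply hb'

theorem SmoothNear.sub {g k : E → F} {a : E} (hg : SmoothNear g a)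
    (hk : SmoothNear k a) : SmoothNear (fun b => g b - k b) a := by
  filter_upwards [hg, hk] with b hb hb'
  exact hb.sub hb'

theorem smoothNear_const (c : F) (a : E) : SmoothNear (fun _ : E => c) a :=
  contDiff_const.smoothNear a

theorem smoothNear_fst (a : E × F) : SmoothNear (fun b : E × F => b.1) a :=
  contDiff_fst.smoothNear a

theorem smoothNear_snd (a : E × F) : SmoothNear (fun b : E × F => b.2) a :=
  contDiff_snd.smoothNear a

end SmoothNear

/-! ### Smooth functions of finitely many jet coordinates -/

section JetCalculus

variable {E F G : Type*} [NormedAddCommGroup E] [NormedSpace ℝ E]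
  [NormedAddCommGroup F] [NormedSpace ℝ F] [NormedAddCommGroup G] [NormedSpace ℝ G]

/-- The truncation `(x, u, u', …) ↦ (x, u, …, u^(N-1))`. -/
def jetTrunc (N : ℕ) : Jet E →L[ℝ] E × (Fin N → Input) :=
  (ContinuousLinearMap.fst ℝ E (ℕ → Input)).prod
    (ContinuousLinearMap.pi fun i : Fin N =>
      (ContinuousLinearMap.proj (R := ℝ) (φ := fun _ : ℕ => Input) (i : ℕ)).comp
        (ContinuousLinearMap.snd ℝ E (ℕ → Input)))

/-- Near the jet `p`, the function `g` is a smooth function of `(x, u, …, u^(N-1))`. The space of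
jets is not normed, so smoothness is that of a function `g'` on the space of truncated jets. -/
def JetSmoothAt (N : ℕ) (g : Jet E → F) (p : Jet E) : Prop :=
  ∃ g' : E × (Fin N → Input) → F, SmoothNear g' (jetTrunc N p) ∧
    ∀ᶠ q in 𝓝 p, g q = g' (jetTrunc N q)

theorem lineDeriv_congr_nhds {g k : Jet E → F} {p : Jet E} (h : g =ᶠ[𝓝 p] k) (v : Jet E) :
    lineDeriv ℝ g p v = lineDeriv ℝ k p v := by
  have hc : Tendsto (fun t : ℝ => p + t • v) (𝓝 0) (𝓝 p) := by
    have : Continuous fun t : ℝ => p + t • v := by fun_prop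
    simpa using this.tendsto 0
  exact EventuallyEq.deriv_eq (hc.eventually h)

theorem lineDeriv_congr_nhds_eventually {g k : Jet E → F} {p : Jet E} (h : g =ᶠ[𝓝 p] k) :
    ∀ᶠ q in 𝓝 p, ∀ v, lineDeriv ℝ g q v = lineDeriv ℝ k q v := by
  filter_upwards [eventually_eventuallyEq_nhds.2 h] with q hq v
  exact lineDeriv_congr_nhds hq v

theorem totalDeriv_congr_nhds {f : E × Input → E} {g k : Jet E → F} {p : Jet E}
    (h : g =ᶠ[𝓝 p] k) : totalDeriv f g =ᶠ[𝓝 p] totalDeriv f k := by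
  filter_upwards [lineDeriv_congr_nhds_eventually h] with q hq
  exact hq _

theorem hasLineDerivAt_comp_linear {T : Type*} [NormedAddCommGroup T] [NormedSpace ℝ T]
    (L : Jet E →L[ℝ] T) {g : T → F} {p : Jet E} (hg : DifferentiableAt ℝ g (L p)) (v : Jet E) :
    HasLineDerivAt ℝ (fun q => g (L q)) (fderiv ℝ g (L p) (L v)) p v := by
  have h : HasLineDerivAt ℝ g (fderiv ℝ g (L p) (L v)) (L p) (L v) :=
    hg.hasFDerivAt.hasLineDerivAt _
  simpa [HasLineDerivAt] using h

theorem lineDeriv_comp_linear {T : Type*} [NormedAddCommGroup T] [NormedSpace ℝ T]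
    (L : Jet E →L[ℝ] T) {g : T → F} {p : Jet E} (hg : DifferentiableAt ℝ g (L p)) (v : Jet E) :
    lineDeriv ℝ (fun q => g (L q)) p v = fderiv ℝ g (L p) (L v) :=
  (hasLineDerivAt_comp_linear L hg v).lineDeriv

theorem lineDeriv_eq_fderiv_of_trunc {N : ℕ} {g : Jet E → F} {g' : E × (Fin N → Input) → F}
    {p : Jet E} (hg' : SmoothNear g' (jetTrunc N p))
    (h : ∀ᶠ q in 𝓝 p, g q = g' (jetTrunc N q)) (v : Jet E) :
    lineDeriv ℝ g p v = fderiv ℝ g' (jetTrunc N p) (jetTrunc N v) := by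
  rw [lineDeriv_congr_nhds h, lineDeriv_comp_linear _ hg'.differentiableAt]

namespace JetSmoothAt

variable {N : ℕ} {g : Jet E → F} {p : Jet E}

theorem eventually (h : JetSmoothAt N g p) : ∀ᶠ q in 𝓝 p, JetSmoothAt N g q := by
  obtain ⟨g', hg', he⟩ := h
  filter_upwards [(jetTrunc N).continuous.continuousAt.eventually hg'.eventually,
    eventually_eventually_nhds.2 he] with q hq hq'
  exact ⟨g', hq, hq'⟩

theorem continuousAt (h : JetSmoothAt N g p) : ContinuousAt g p := by
  obtain ⟨g', hg', he⟩ := h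
  have : ContinuousAt (fun q => g' (jetTrunc N q)) p :=
    ContinuousAt.comp (g := g') hg'.continuousAt (jetTrunc N).continuous.continuousAt
  exact this.congr (he.mono fun q hq => hq.symm)

theorem mono (h : JetSmoothAt N g p) {M : ℕ} (hNM : N ≤ M) : JetSmoothAt M g p := by
  obtain ⟨g', hg', he⟩ := h
  let r : E × (Fin M → Input) → E × (Fin N → Input) :=
    fun y => (y.1, fun i => y.2 (Fin.castLE hNM i))
  have hr : ContDiff ℝ ∞ r := by fun_prop
  exact ⟨fun y => g' (r y), SmoothNear.comp (g := g') (k := r) hg' (hr.smoothNear _), he⟩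

theorem comp {k : F → G} (hk : SmoothNear k (g p)) (h : JetSmoothAt N g p) :
    JetSmoothAt N (fun q => k (g q)) p := by
  obtain ⟨g', hg', he⟩ := h
  rw [he.self_of_nhds] at hk
  exact ⟨fun y => k (g' y), hk.comp hg', he.mono fun q hq => by simp only [hq]⟩

theorem lineDeriv_comp {k : F → G} (hk : SmoothNear k (g p)) (h : JetSmoothAt N g p)
    (v : Jet E) : lineDeriv ℝ (fun q => k (g q)) p v = fderiv ℝ k (g p) (lineDeriv ℝ g p v) := by
  obtain ⟨g', hg', he⟩ := h
  have hk' := hk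
  rw [he.self_of_nhds] at hk'
  rw [lineDeriv_eq_fderiv_of_trunc (g' := fun y => k (g' y)) (hk'.comp hg')
    (he.mono fun q hq => by simp only [hq]), lineDeriv_eq_fderiv_of_trunc hg' he,
    fderiv_fun_comp _ hk'.differentiableAt hg'.differentiableAt, he.self_of_nhds]
  rfl

theorem pi {ι : Type*} [Fintype ι] {H : ι → Type*} [∀ i, NormedAddCommGroup (H i)]
    [∀ i, NormedSpace ℝ (H i)] {g : (i : ι) → Jet E → H i} (hg : ∀ i, JetSmoothAt N (g i) p) :
    JetSmoothAt N (fun q i => g i q) p := by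
  choose g' hg' he using hg
  refine ⟨fun y i => g' i y, SmoothNear.pi hg', ?_⟩
  filter_upwards [eventually_all.2 he] with q hq
  exact funext hq

theorem lineDeriv_pi {ι : Type*} [Fintype ι] {H : ι → Type*} [∀ i, NormedAddCommGroup (H i)]
    [∀ i, NormedSpace ℝ (H i)] {g : (i : ι) → Jet E → H i} (hg : ∀ i, JetSmoothAt N (g i) p)
    (v : Jet E) :
    lineDeriv ℝ (fun q i => g i q) p v = fun i => lineDeriv ℝ (g i) p v := by
  choose g' hg' he using hg
  rw [lineDeriv_eq_fderiv_of_trunc (g' := fun y i => g' i y) (SmoothNear.pi hg')]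
  · rw [fderiv_pi fun i => (hg' i).differentiableAt]
    ext i
    simp [lineDeriv_eq_fderiv_of_trunc (hg' i) (he i)]
  · filter_upwards [eventually_all.2 he] with q hq
    exact funext hq

theorem prodMk {k : Jet E → G} (hg : JetSmoothAt N g p) (hk : JetSmoothAt N k p) :
    JetSmoothAt N (fun q => (g q, k q)) p := by
  obtain ⟨g', hg', he⟩ := hg
  obtain ⟨k', hk', he'⟩ := hk
  refine ⟨fun y => (g' y, k' y), hg'.prodMk hk', ?_⟩
  filter_upwards [he, he'] with q h1 h2
  rw [h1, h2]

theorem lineDeriv_prodMk {k : Jet E → G} (hg : JetSmoothAt N g p) (hk : JetSmoothAt N k p)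
    (v : Jet E) :
    lineDeriv ℝ (fun q => (g q, k q)) p v = (lineDeriv ℝ g p v, lineDeriv ℝ k p v) := by
  obtain ⟨g', hg', he⟩ := hg
  obtain ⟨k', hk', he'⟩ := hk
  rw [lineDeriv_eq_fderiv_of_trunc (g' := fun y => (g' y, k' y)) (hg'.prodMk hk'),
    lineDeriv_eq_fderiv_of_trunc hg' he, lineDeriv_eq_fderiv_of_trunc hk' he',
    hg'.differentiableAt.fderiv_prodMk hk'.differentiableAt]
  · rfl
  · filter_upwards [he, he'] with q h1 h2
    rw [h1, h2]

theorem lineDeriv_add (h : JetSmoothAt N g p) (v w : Jet E) :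
    lineDeriv ℝ g p (v + w) = lineDeriv ℝ g p v + lineDeriv ℝ g p w := by
  obtain ⟨g', hg', he⟩ := h
  simp only [lineDeriv_eq_fderiv_of_trunc hg' he, map_add]

theorem lineDeriv_smul (h : JetSmoothAt N g p) (c : ℝ) (v : Jet E) :
    lineDeriv ℝ g p (c • v) = c • lineDeriv ℝ g p v := by
  obtain ⟨g', hg', he⟩ := h
  simp only [lineDeriv_eq_fderiv_of_trunc hg' he, map_smul]

theorem lineDeriv_eq_zero (h : JetSmoothAt N g p) {v : Jet E} (hv : jetTrunc N v = 0) :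
    lineDeriv ℝ g p v = 0 := by
  obtain ⟨g', hg', he⟩ := h
  rw [lineDeriv_eq_fderiv_of_trunc hg' he, hv, map_zero]

theorem fst (p : Jet E) : JetSmoothAt N (fun q : Jet E => q.1) p :=
  ⟨fun y => y.1, contDiff_fst.smoothNear _, Eventually.of_forall fun _ => rfl⟩

theorem snd {i : ℕ} (hi : i < N) (p : Jet E) : JetSmoothAt N (fun q : Jet E => q.2 i) p :=
  ⟨fun y => y.2 ⟨i, hi⟩, ContDiff.smoothNear (by fun_prop) _, Eventually.of_forall fun _ => rfl⟩

theorem base {ψ : E × Input → F} (hψ : SmoothNear ψ (p.1, p.2 0)) :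
    JetSmoothAt 1 (fun q : Jet E => ψ (q.1, q.2 0)) p :=
  comp (g := fun q : Jet E => (q.1, q.2 0)) hψ ((fst p).prodMk (snd one_pos p))

end JetSmoothAt

/-- The Cartan field, as a map between truncated jets. It involves one more derivative of the input
than the components that are kept. -/
def truncCartan (f : E × Input → E) (N : ℕ) (y : E × (Fin (N + 1) → Input)) :
    E × (Fin N → Input) :=
  (f (y.1, y.2 0), fun i => y.2 i.succ)

/-- Forgetting the highest derivative of the input. -/
def truncInit (N : ℕ) : E × (Fin (N + 1) → Input) →L[ℝ] E × (Fin N → Input) :=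
  (ContinuousLinearMap.fst ℝ E (Fin (N + 1) → Input)).prod
    (ContinuousLinearMap.pi fun i : Fin N =>
      (ContinuousLinearMap.proj (R := ℝ) (φ := fun _ : Fin (N + 1) => Input) i.castSucc).comp
        (ContinuousLinearMap.snd ℝ E (Fin (N + 1) → Input)))

theorem truncInit_jetTrunc (N : ℕ) (p : Jet E) :
    truncInit N (jetTrunc (N + 1) p) = jetTrunc N p := rfl

theorem truncCartan_jetTrunc (f : E × Input → E) (N : ℕ) (p : Jet E) :
    truncCartan f N (jetTrunc (N + 1) p) = jetTrunc N (cartanField f p) := rfl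

theorem differentiableAt_truncCartan {f : E × Input → E} {N : ℕ} {y : E × (Fin (N + 1) → Input)}
    (hf : DifferentiableAt ℝ f (y.1, y.2 0)) :
    DifferentiableAt ℝ (truncCartan f N) y ∧ ∀ w, fderiv ℝ (truncCartan f N) y w =
      (fderiv ℝ f (y.1, y.2 0) (w.1, w.2 0), fun i => w.2 i.succ) := by
  let b : E × (Fin (N + 1) → Input) →L[ℝ] E × Input :=
    (ContinuousLinearMap.fst ℝ E (Fin (N + 1) → Input)).prod
      ((ContinuousLinearMap.proj (R := ℝ) (φ := fun _ : Fin (N + 1) => Input) 0).comp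
        (ContinuousLinearMap.snd ℝ E (Fin (N + 1) → Input)))
  let s : E × (Fin (N + 1) → Input) →L[ℝ] (Fin N → Input) :=
    ContinuousLinearMap.pi fun i : Fin N =>
      (ContinuousLinearMap.proj (R := ℝ) (φ := fun _ : Fin (N + 1) => Input) i.succ).comp
        (ContinuousLinearMap.snd ℝ E (Fin (N + 1) → Input))
  have h : HasFDerivAt (truncCartan f N) (((fderiv ℝ f (y.1, y.2 0)).comp b).prod s) y :=
    HasFDerivAt.prodMk (HasFDerivAt.comp (g := f) y hf.hasFDerivAt b.hasFDerivAt) s.hasFDerivAt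
  exact ⟨h.differentiableAt, fun w => by rw [h.fderiv]; rfl⟩

theorem smoothNear_truncCartan {f : E × Input → E} {N : ℕ} {y : E × (Fin (N + 1) → Input)}
    (hf : SmoothNear f (y.1, y.2 0)) : SmoothNear (truncCartan f N) y := by
  refine SmoothNear.prodMk (SmoothNear.comp (g := f)
    (k := fun y : E × (Fin (N + 1) → Input) => (y.1, y.2 0)) hf ?_) ?_ <;>
  exact ContDiff.smoothNear (by fun_prop) _

theorem totalDeriv_eq_of_trunc {f : E × Input → E} {N : ℕ} {g : Jet E → F}
    {g' : E × (Fin N → Input) → F} {p : Jet E} (hg' : SmoothNear g' (jetTrunc N p))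
    (h : ∀ᶠ q in 𝓝 p, g q = g' (jetTrunc N q)) :
    ∀ᶠ q in 𝓝 p, totalDeriv f g q = fderiv ℝ g' (truncInit N (jetTrunc (N + 1) q))
      (truncCartan f N (jetTrunc (N + 1) q)) := by
  filter_upwards [(jetTrunc N).continuous.continuousAt.eventually hg'.eventually,
    eventually_eventually_nhds.2 h] with q h1 h2
  exact lineDeriv_eq_fderiv_of_trunc h1 h2 _

theorem smoothNear_truncTotalDeriv {f : E × Input → E} {N : ℕ}
    {g' : E × (Fin N → Input) → F} {p : Jet E} (hg' : SmoothNear g' (jetTrunc N p))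
    (hf : SmoothNear f (p.1, p.2 0)) :
    SmoothNear (fun y => fderiv ℝ g' (truncInit N y) (truncCartan f N y))
      (jetTrunc (N + 1) p) := by
  have h1 : SmoothNear (fderiv ℝ g') (truncInit N (jetTrunc (N + 1) p)) := by
    rw [truncInit_jetTrunc]
    exact hg'.fderiv
  have h2 : SmoothNear (truncCartan f N) (jetTrunc (N + 1) p) := smoothNear_truncCartan hf
  exact (h1.comp ((truncInit (E := E) N).contDiff.smoothNear _)).clm_apply h2

theorem JetSmoothAt.totalDeriv {f : E × Input → E} {N : ℕ} {g : Jet E → F} {p : Jet E}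
    (h : JetSmoothAt N g p) (hf : SmoothNear f (p.1, p.2 0)) :
    JetSmoothAt (N + 1) (totalDeriv f g) p := by
  obtain ⟨g', hg', he⟩ := h
  exact ⟨_, smoothNear_truncTotalDeriv hg' hf, totalDeriv_eq_of_trunc hg' he⟩

/-- The commutator of a constant field `v` and the Cartan field is the derivative of the Cartan
field in the direction `v`. -/
theorem JetSmoothAt.lineDeriv_totalDeriv {f : E × Input → E} {N : ℕ} {g : Jet E → F} {p : Jet E}
    (h : JetSmoothAt N g p) (hf : SmoothNear f (p.1, p.2 0)) (v : Jet E) :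
    lineDeriv ℝ (_root_.totalDeriv f g) p v =
      _root_.totalDeriv f (fun q => lineDeriv ℝ g q v) p +
        lineDeriv ℝ g p (fderiv ℝ f (p.1, p.2 0) (v.1, v.2 0), fun i => v.2 (i + 1)) := by
  obtain ⟨g', hg', he⟩ := h
  have hv : ∀ᶠ q in 𝓝 p, lineDeriv ℝ g q v =
      (fun y => fderiv ℝ g' y (jetTrunc N v)) (jetTrunc N q) := by
    filter_upwards [(jetTrunc N).continuous.continuousAt.eventually hg'.eventually,
      eventually_eventually_nhds.2 he] with q h1 h2
    exact lineDeriv_eq_fderiv_of_trunc h1 h2 v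
  have hg2 := SmoothNear.fderiv hg'
  obtain ⟨hc, hc'⟩ := differentiableAt_truncCartan (N := N) (y := jetTrunc (N + 1) p)
    (f := f) hf.differentiableAt
  have hsymm : IsSymmSndFDerivAt ℝ g' (jetTrunc N p) :=
    hg'.contDiffAt.isSymmSndFDerivAt (by
      rw [minSmoothness_of_isRCLikeNormedField]
      exact WithTop.coe_le_coe.2 le_top)
  have hA : DifferentiableAt ℝ (fun y => fderiv ℝ g' (truncInit N y)) (jetTrunc (N + 1) p) :=
    DifferentiableAt.comp (g := fderiv ℝ g') _ hg2.differentiableAt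
      (truncInit (E := E) N).differentiableAt
  rw [lineDeriv_eq_fderiv_of_trunc (smoothNear_truncTotalDeriv hg' hf) (totalDeriv_eq_of_trunc hg' he),
    fderiv_clm_apply hA hc, lineDeriv_eq_fderiv_of_trunc hg' he]
  rw [_root_.totalDeriv, lineDeriv_eq_fderiv_of_trunc
    (SmoothNear.clm_apply hg2 (smoothNear_const _ _)) hv,
    fderiv_clm_apply hg2.differentiableAt (differentiableAt_const _)]
  have hA' : fderiv ℝ (fun y => fderiv ℝ g' (truncInit N y)) (jetTrunc (N + 1) p) =
      (fderiv ℝ (fderiv ℝ g') (jetTrunc N p)).comp (truncInit N) := by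
    exact (HasFDerivAt.comp (g := fderiv ℝ g') (jetTrunc (N + 1) p)
      hg2.differentiableAt.hasFDerivAt (truncInit (E := E) N).hasFDerivAt).fderiv
  simp only [hA', hc', add_apply, ContinuousLinearMap.comp_apply,
    ContinuousLinearMap.flip_apply, truncInit_jetTrunc, truncCartan_jetTrunc]
  -- The terms with second derivatives of `g'` agree by symmetry.
  rw [hsymm (jetTrunc N v) (jetTrunc N (cartanField f p)), add_comm]
  simp
  rfl

end JetCalculus

/-! ### Time derivatives and maps of jets -/

section OutputDeriv

variable {E F G : Type*} [NormedAddCommGroup E] [NormedSpace ℝ E]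
  [NormedAddCommGroup F] [NormedSpace ℝ F] [NormedAddCommGroup G] [NormedSpace ℝ G]

theorem lineDeriv_jet_fst (p v : Jet E) : lineDeriv ℝ (fun q : Jet E => q.1) p v = v.1 := by
  simpa using lineDeriv_comp_linear (ContinuousLinearMap.fst ℝ E (ℕ → Input)) (g := id)
    (p := p) differentiableAt_id v

theorem lineDeriv_jet_snd (i : ℕ) (p v : Jet E) :
    lineDeriv ℝ (fun q : Jet E => q.2 i) p v = v.2 i := by
  simpa using lineDeriv_comp_linear
    ((ContinuousLinearMap.proj (R := ℝ) (φ := fun _ : ℕ => Input) i).comp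
      (ContinuousLinearMap.snd ℝ E (ℕ → Input))) (g := id) (p := p) differentiableAt_id v

theorem continuous_jet_base {E : Type*} [TopologicalSpace E] :
    Continuous fun p : Jet E => (p.1, p.2 0) := by fun_prop

theorem outputDeriv_zero (f : E × Input → E) (φ : E × Input → F) (p : Jet E) :
    outputDeriv f φ 0 p = φ (p.1, p.2 0) := rfl

theorem outputDeriv_succ (f : E × Input → E) (φ : E × Input → F) (i : ℕ) :
    outputDeriv f φ (i + 1) = totalDeriv f (outputDeriv f φ i) :=
  Function.iterate_succ_apply' _ _ _

/-- The `i`-th derivative of a function of `(x, u)` involves the input up to its `i`-th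
derivative. -/
theorem jetSmoothAt_outputDeriv {f : E × Input → E} {φ : E × Input → F} {p : Jet E}
    (hf : SmoothNear f (p.1, p.2 0)) (hφ : SmoothNear φ (p.1, p.2 0)) (i : ℕ) :
    JetSmoothAt (i + 1) (outputDeriv f φ i) p := by
  induction i with
  | zero => exact JetSmoothAt.base hφ
  | succ i ih => rw [outputDeriv_succ]; exact ih.totalDeriv hf

theorem outputDeriv_congr {f : E × Input → E} {φ ψ : E × Input → F} {p : Jet E}
    (h : φ =ᶠ[𝓝 (p.1, p.2 0)] ψ) (i : ℕ) : outputDeriv f φ i =ᶠ[𝓝 p] outputDeriv f ψ i := by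
  induction i with
  | zero => exact continuous_jet_base.continuousAt.eventually h
  | succ i ih => simp only [outputDeriv_succ]; exact totalDeriv_congr_nhds ih

theorem outputDeriv_snd (f : E × Input → E) (i : ℕ) (p : Jet E) :
    outputDeriv f (fun b => b.2) i p = p.2 i := by
  induction i generalizing p with
  | zero => rfl
  | succ i ih =>
    rw [outputDeriv_succ, funext ih, totalDeriv, lineDeriv_jet_snd]
    rfl

theorem JetSmoothAt.lineDeriv_apply {N : ℕ} {g : Jet E → Fin 2 → ℝ} {p : Jet E}
    (h : JetSmoothAt N g p) (c : Fin 2) (v : Jet E) :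
    lineDeriv ℝ (fun q => g q c) p v = lineDeriv ℝ g p v c := by
  have := h.lineDeriv_comp (k := ContinuousLinearMap.proj (R := ℝ) (φ := fun _ : Fin 2 => ℝ) c)
    ((ContinuousLinearMap.contDiff _).smoothNear _) v
  rw [ContinuousLinearMap.fderiv] at this
  exact this

theorem outputDeriv_apply {f : E × Input → E} {φ : E × Input → Fin 2 → ℝ} {p : Jet E}
    (hf : SmoothNear f (p.1, p.2 0)) (hφ : SmoothNear φ (p.1, p.2 0)) (c : Fin 2) (i : ℕ) :
    ∀ᶠ q in 𝓝 p, outputDeriv f (fun b => φ b c) i q = outputDeriv f φ i q c := by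
  induction i with
  | zero => exact Eventually.of_forall fun _ => rfl
  | succ i ih =>
    rw [outputDeriv_succ, outputDeriv_succ]
    filter_upwards [totalDeriv_congr_nhds (f := f) ih,
      (jetSmoothAt_outputDeriv hf hφ i).eventually] with q h1 h2
    rw [h1]
    exact h2.lineDeriv_apply c _

/-- The map `(x, u, u', …) ↦ (x, ū, ū', …)` of jets that is induced by the change of input
`ū = g (x, u)`. -/
def jetMap (f : E × Input → E) (g : E × Input → Input) (p : Jet E) : Jet E :=
  (p.1, fun i => outputDeriv f g i p)

theorem jetSmoothAt_trunc_jetMap {f : E × Input → E} {g : E × Input → Input} {p : Jet E}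
    (hf : SmoothNear f (p.1, p.2 0)) (hg : SmoothNear g (p.1, p.2 0)) (N : ℕ) :
    JetSmoothAt N (fun q => jetTrunc N (jetMap f g q)) p :=
  (JetSmoothAt.fst p).prodMk (JetSmoothAt.pi fun i : Fin N =>
    (jetSmoothAt_outputDeriv hf hg i).mono i.2)

theorem lineDeriv_trunc_jetMap {f : E × Input → E} {g : E × Input → Input} {p : Jet E}
    (hf : SmoothNear f (p.1, p.2 0)) (hg : SmoothNear g (p.1, p.2 0)) (N : ℕ) (v : Jet E) :
    lineDeriv ℝ (fun q => jetTrunc N (jetMap f g q)) p v =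
      jetTrunc N (v.1, fun i => lineDeriv ℝ (outputDeriv f g i) p v) := by
  have h : ∀ i : Fin N, JetSmoothAt N (outputDeriv f g i) p := fun i =>
    (jetSmoothAt_outputDeriv hf hg i).mono i.2
  have := (JetSmoothAt.fst (N := N) p).lineDeriv_prodMk (JetSmoothAt.pi h) v
  rw [JetSmoothAt.lineDeriv_pi h, lineDeriv_jet_fst] at this
  exact this

theorem continuousAt_jetMap {f : E × Input → E} {g : E × Input → Input} {p : Jet E}
    (hf : SmoothNear f (p.1, p.2 0)) (hg : SmoothNear g (p.1, p.2 0)) :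
    ContinuousAt (jetMap f g) p :=
  continuousAt_fst.prodMk (continuousAt_pi.2 fun i =>
    (jetSmoothAt_outputDeriv hf hg i).continuousAt)

/-- The chain rule for `jetMap`. -/
theorem lineDeriv_comp_jetMap {f : E × Input → E} {g : E × Input → Input} {p : Jet E}
    (hf : SmoothNear f (p.1, p.2 0)) (hg : SmoothNear g (p.1, p.2 0)) {N : ℕ}
    {k : Jet E → F} (hk : JetSmoothAt N k (jetMap f g p)) (v : Jet E) :
    lineDeriv ℝ (fun q => k (jetMap f g q)) p v =
      lineDeriv ℝ k (jetMap f g p) (v.1, fun i => lineDeriv ℝ (outputDeriv f g i) p v) := by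
  obtain ⟨k', hk', he⟩ := hk
  have h1 : (fun q => k (jetMap f g q)) =ᶠ[𝓝 p] fun q => k' (jetTrunc N (jetMap f g q)) :=
    (continuousAt_jetMap hf hg).tendsto.eventually he
  rw [lineDeriv_congr_nhds h1, lineDeriv_eq_fderiv_of_trunc hk' he, ← lineDeriv_trunc_jetMap hf hg,
    ← JetSmoothAt.lineDeriv_comp (g := fun q => jetTrunc N (jetMap f g q)) hk'
      (jetSmoothAt_trunc_jetMap hf hg N)]

/-- The map of jets that is induced by a change of input takes the time derivatives along one
system to those along the other. -/
theorem outputDeriv_jetMap {f f' : E × Input → E} {g : E × Input → Input} {p : Jet E}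
    (hf : SmoothNear f (p.1, p.2 0)) (hg : SmoothNear g (p.1, p.2 0))
    (hf' : SmoothNear f' (p.1, g (p.1, p.2 0)))
    (hff' : ∀ᶠ b in 𝓝 (p.1, p.2 0), f' (b.1, g b) = f b)
    {ψ : E × Input → F} (hψ : SmoothNear ψ (p.1, g (p.1, p.2 0))) (i : ℕ) :
    ∀ᶠ q in 𝓝 p, outputDeriv f' ψ i (jetMap f g q) =
      outputDeriv f (fun b => ψ (b.1, g b)) i q := by
  induction i with
  | zero => exact Eventually.of_forall fun _ => rfl
  | succ i ih =>
    have hs : JetSmoothAt (i + 1) (outputDeriv f' ψ i) (jetMap f g p) :=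
      jetSmoothAt_outputDeriv hf' hψ i
    filter_upwards [eventually_eventually_nhds.2 ih,
      continuous_jet_base.continuousAt.eventually hf.eventually,
      continuous_jet_base.continuousAt.eventually hg.eventually,
      continuous_jet_base.continuousAt.eventually hff',
      (continuousAt_jetMap hf hg).eventually hs.eventually] with q h1 h2 h3 h4 h5
    rw [outputDeriv_succ, outputDeriv_succ, totalDeriv, totalDeriv, ← lineDeriv_congr_nhds h1,
      lineDeriv_comp_jetMap h2 h3 h5]
    congr 1
    refine Prod.ext h4 (funext fun i => ?_)
    change outputDeriv f g (i + 1) q = _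
    rw [outputDeriv_succ]
    rfl

end OutputDeriv

/-! ### Relative degree and the independence of the differentials of the outputs -/

section RelativeDegree

variable {S : Type*} [NormedAddCommGroup S] [NormedSpace ℝ S]

/-- The iterated derivatives of a function of the state and the input along `x' = F (x, u)` while
the input is held constant. They are the time derivatives of the function as long as these do not
depend on the input. -/
def frozenDeriv (F : S × Input → S) (y : S × Input → ℝ) : ℕ → S × Input → ℝ
  | 0 => y
  | i + 1 => fun q => fderiv ℝ (frozenDeriv F y i) q (F q, 0)

/-- The outputs `y` of `x' = F (x, u)` have vector relative degree `ρ` at `a`: the derivatives of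
`y l` of order less than `ρ l` do not depend on the input, and the derivatives of order `ρ l` have
an invertible Jacobian matrix with respect to the input. -/
structure HasRelativeDegreeAt (F : S × Input → S) (y : S × Input → Fin 2 → ℝ) (ρ : Fin 2 → ℕ)
    (a : S × Input) : Prop where
  smooth_field : SmoothNear F a
  smooth_output : SmoothNear y a
  input_free : ∀ l, ∀ i < ρ l, ∀ᶠ q in 𝓝 a, ∀ w : Input,
    fderiv ℝ (frozenDeriv F (fun b => y b l) i) q (0, w) = 0
  decoupling : ∀ w : Input,
    (∀ l, fderiv ℝ (frozenDeriv F (fun b => y b l) (ρ l)) a (0, w) = 0) → w = 0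

theorem smoothNear_frozenDeriv {F : S × Input → S} {y : S × Input → ℝ} {a : S × Input}
    (hF : SmoothNear F a) (hy : SmoothNear y a) (i : ℕ) : SmoothNear (frozenDeriv F y i) a := by
  induction i with
  | zero => exact hy
  | succ i ih => exact ih.fderiv.clm_apply (hF.prodMk (smoothNear_const 0 a))

/-- The iterated Lie brackets of the drift field `(F, 0)` with the constant field `(0, w)`. -/
def adField (F : S × Input → S) (w : Input) : ℕ → S × Input → S × Input
  | 0 => fun _ => (0, w)
  | m + 1 => VectorField.lieBracket ℝ (fun q => (F q, 0)) (adField F w m)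

theorem smoothNear_adField {F : S × Input → S} {a : S × Input} (hF : SmoothNear F a) (w : Input)
    (m : ℕ) : SmoothNear (adField F w m) a := by
  have hX : SmoothNear (fun q : S × Input => (F q, (0 : Input))) a :=
    hF.prodMk (smoothNear_const 0 a)
  induction m with
  | zero => exact smoothNear_const _ a
  | succ m ih => exact (ih.fderiv.clm_apply hX).sub (hX.fderiv.clm_apply ih)

theorem fderiv_adField_succ {F : S × Input → S} {y : S × Input → ℝ} {a : S × Input}
    (hF : SmoothNear F a) (hy : SmoothNear y a) (w : Input) (m i : ℕ) :
    fderiv ℝ (frozenDeriv F y i) a (adField F w (m + 1) a) =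
      fderiv ℝ (fun q => fderiv ℝ (frozenDeriv F y i) q (adField F w m q)) a (F a, 0) -
        fderiv ℝ (frozenDeriv F y (i + 1)) a (adField F w m a) :=
  VectorField.fderiv_apply_lieBracket (V := fun q : S × Input => (F q, (0 : Input)))
    (W := adField F w m) (smoothNear_frozenDeriv hF hy i).contDiffAt
    (by
      rw [minSmoothness_of_isRCLikeNormedField]
      exact WithTop.coe_le_coe.2 le_top)
    (smoothNear_adField hF w m).differentiableAt
    (hF.prodMk (smoothNear_const 0 a)).differentiableAt

namespace HasRelativeDegreeAt

variable {F : S × Input → S} {y : S × Input → Fin 2 → ℝ} {ρ : Fin 2 → ℕ} {a : S × Input}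

theorem eventually_smooth (h : HasRelativeDegreeAt F y ρ a) :
    ∀ᶠ q in 𝓝 a, SmoothNear F q ∧ ∀ l, SmoothNear (fun b => y b l) q := by
  filter_upwards [h.smooth_field.eventually, h.smooth_output.eventually] with q h1 h2
  exact ⟨h1, fun l => SmoothNear.comp (g := fun z : Fin 2 → ℝ => z l)
    (ContDiff.smoothNear (by fun_prop) _) h2⟩

theorem smooth_frozenDeriv (h : HasRelativeDegreeAt F y ρ a) (l : Fin 2) (i : ℕ) :
    SmoothNear (frozenDeriv F (fun b => y b l) i) a :=
  smoothNear_frozenDeriv h.smooth_field (h.eventually_smooth.self_of_nhds.2 l) i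

/-- The bracket of order `m` annihilates the derivatives of `y l` of order less than `ρ l - m`; on
the derivative of order `ρ l - m` it gives, up to sign, the entry of the decoupling matrix. -/
theorem fderiv_adField (h : HasRelativeDegreeAt F y ρ a) (w : Input) (l : Fin 2) (m : ℕ) :
    (∀ i, i + m < ρ l → ∀ᶠ q in 𝓝 a,
      fderiv ℝ (frozenDeriv F (fun b => y b l) i) q (adField F w m q) = 0) ∧
    ∀ i, i + m = ρ l → ∀ᶠ q in 𝓝 a,
      fderiv ℝ (frozenDeriv F (fun b => y b l) i) q (adField F w m q) =
        (-1) ^ m * fderiv ℝ (frozenDeriv F (fun b => y b l) (ρ l)) q (0, w) := by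
  induction m with
  | zero =>
    refine ⟨fun i hi => ?_, fun i hi => Eventually.of_forall fun q => ?_⟩
    · filter_upwards [h.input_free l i hi] with q hq
      exact hq w
    · rw [← hi]
      simp [adField]
  | succ m ih =>
    have key : ∀ i, i + m < ρ l → ∀ᶠ q in 𝓝 a,
        fderiv ℝ (frozenDeriv F (fun b => y b l) i) q (adField F w (m + 1) q) =
          - fderiv ℝ (frozenDeriv F (fun b => y b l) (i + 1)) q (adField F w m q) := by
      intro i hi
      filter_upwards [h.eventually_smooth, eventually_eventually_nhds.2 (ih.1 i hi)] with q h1 h2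
      have h3 : (fun q => fderiv ℝ (frozenDeriv F (fun b => y b l) i) q (adField F w m q))
          =ᶠ[𝓝 q] fun _ => 0 := h2
      rw [fderiv_adField_succ h1.1 (h1.2 l), h3.fderiv_eq]
      simp
    refine ⟨fun i hi => ?_, fun i hi => ?_⟩
    · filter_upwards [key i (by omega), ih.1 (i + 1) (by omega)] with q h1 h2
      rw [h1, h2, neg_zero]
    · filter_upwards [key i (by omega), ih.2 (i + 1) (by omega)] with q h1 h2
      rw [h1, h2, pow_succ]
      ring

/-- The decoupling matrix is surjective, being an injective square matrix. -/
theorem exists_input (h : HasRelativeDegreeAt F y ρ a) (t : Fin 2 → ℝ) :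
    ∃ w : Input, ∀ l, fderiv ℝ (frozenDeriv F (fun b => y b l) (ρ l)) a (0, w) = t l := by
  let β : Input →ₗ[ℝ] (Fin 2 → ℝ) := LinearMap.pi fun l =>
    (fderiv ℝ (frozenDeriv F (fun b => y b l) (ρ l)) a : S × Input →ₗ[ℝ] ℝ) ∘ₗ
      LinearMap.inr ℝ S Input
  have hβ : Function.Injective β := by
    rw [← LinearMap.ker_eq_bot, LinearMap.ker_eq_bot']
    exact fun w hw => h.decoupling w fun l => congrFun hw l
  obtain ⟨w, hw⟩ := LinearMap.surjective_of_injective hβ t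
  exact ⟨w, fun l => congrFun hw l⟩

/-- The differentials of the outputs and of their derivatives of order at most `ρ l` are linearly
independent. The matrix of their values on the iterated brackets is block triangular, with the
decoupling matrix in the diagonal blocks. -/
theorem linearIndependent (h : HasRelativeDegreeAt F y ρ a) :
    LinearIndependent ℝ fun s : (l : Fin 2) × Fin (ρ l + 1) =>
      (fderiv ℝ (frozenDeriv F (fun b => y b s.1) s.2) a : S × Input →ₗ[ℝ] ℝ) := by
  rw [Fintype.linearIndependent_iff]
  intro c hc
  have hc' : ∀ v : S × Input, ∑ l, ∑ i : Fin (ρ l + 1),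
      c ⟨l, i⟩ * fderiv ℝ (frozenDeriv F (fun b => y b l) i) a v = 0 := by
    intro v
    have := LinearMap.congr_fun hc v
    simpa [LinearMap.sum_apply, Fintype.sum_sigma] using this
  have main : ∀ m l (i : Fin (ρ l + 1)), (i : ℕ) + m = ρ l → c ⟨l, i⟩ = 0 := by
    intro m
    induction m using Nat.strong_induction_on with
    | _ m ih =>
    intro l₀ i₀ hi₀
    -- With this `w`, the bracket of order `m` sees only the coefficient at `⟨l₀, i₀⟩`: the
    -- functions of lower order are annihilated, and the coefficients of higher order vanish by
    -- induction.
    obtain ⟨w, hw⟩ := h.exists_input (Pi.single l₀ ((-1) ^ m))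
    have h1 := hc' (adField F w m a)
    rw [Finset.sum_eq_single l₀, Finset.sum_eq_single i₀] at h1
    · rw [((h.fderiv_adField w l₀ m).2 _ hi₀).self_of_nhds, hw, Pi.single_eq_same,
        ← mul_pow] at h1
      simpa using h1
    · intro i _ hi
      have hne : (i : ℕ) ≠ i₀ := fun h => hi (Fin.ext h)
      rcases lt_or_gt_of_ne hne with hlt | hgt
      · rw [((h.fderiv_adField w l₀ m).1 i (by omega)).self_of_nhds, mul_zero]
      · rw [ih (ρ l₀ - i) (by omega) l₀ i (by omega), zero_mul]
    · simp
    · intro l _ hl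
      refine Finset.sum_eq_zero fun i _ => ?_
      rcases lt_trichotomy ((i : ℕ) + m) (ρ l) with hlt | heq | hgt
      · rw [((h.fderiv_adField w l m).1 i hlt).self_of_nhds, mul_zero]
      · rw [((h.fderiv_adField w l m).2 i heq).self_of_nhds, hw, Pi.single_eq_of_ne hl]
        simp
      · rw [ih (ρ l - i) (by omega) l i (by omega), zero_mul]
    · simp
  rintro ⟨l, i⟩
  exact main (ρ l - i) l i (by omega)

variable [FiniteDimensional ℝ S]

theorem sum_le_finrank (h : HasRelativeDegreeAt F y ρ a) :
    ρ 0 + ρ 1 ≤ Module.finrank ℝ S := by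
  have h1 := h.linearIndependent.fintype_card_le_finrank
  rw [Module.finrank_linearMap_self, Module.finrank_prod] at h1
  simp [Fintype.card_sigma] at h1
  omega

/-- When the relative degrees add up to the dimension, the differentials in the two chains form a
basis of the dual space. -/
theorem eq_zero_of_fderiv_eq_zero (h : HasRelativeDegreeAt F y ρ a)
    (hρ : ρ 0 + ρ 1 = Module.finrank ℝ S) {v : S × Input}
    (hv : ∀ l, ∀ i ≤ ρ l, fderiv ℝ (frozenDeriv F (fun b => y b l) i) a v = 0) : v = 0 := by
  have h1 := h.linearIndependent.span_eq_top_of_card_eq_finrank' (by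
    rw [Module.finrank_linearMap_self, Module.finrank_prod]
    simp [Fintype.card_sigma]
    omega)
  rw [← Module.forall_dual_apply_eq_zero_iff ℝ]
  intro ξ
  have hξ : ξ ∈ Submodule.span ℝ (Set.range fun s : (l : Fin 2) × Fin (ρ l + 1) =>
      (fderiv ℝ (frozenDeriv F (fun b => y b s.1) s.2) a : S × Input →ₗ[ℝ] ℝ)) := by
    rw [h1]; trivial
  induction hξ using Submodule.span_induction with
  | mem x hx =>
    obtain ⟨⟨l, i⟩, rfl⟩ := hx
    exact hv l i (Nat.lt_succ_iff.1 i.2)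
  | zero => rfl
  | add x z _ _ hx hz => rw [LinearMap.add_apply, hx, hz, add_zero]
  | smul c x _ hx => rw [LinearMap.smul_apply, hx, smul_zero]

end HasRelativeDegreeAt

end RelativeDegree

/-! ### Brunovský normal form from a full relative degree -/

section LocalDiffeo

variable {E F : Type*} [NormedAddCommGroup E] [NormedSpace ℝ E]
  [NormedAddCommGroup F] [NormedSpace ℝ F]

/-- The inverse function theorem, as a statement on local diffeomorphisms. -/
theorem isLocalDiffeomorphAt_of_smoothNear [CompleteSpace E] {g : E → F} {a : E}
    (hg : SmoothNear g a) (e : E ≃L[ℝ] F) (he : HasFDerivAt g (e : E →L[ℝ] F) a) :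
    IsLocalDiffeomorphAt 𝓘(ℝ, E) 𝓘(ℝ, F) ∞ g a := by
  have hU : ∀ᶠ b in 𝓝 a, ContDiffAt ℝ ∞ g b ∧
      fderiv ℝ g b ∈ Set.range ((↑) : (E ≃L[ℝ] F) → E →L[ℝ] F) := by
    refine hg.and (hg.fderiv.continuousAt.eventually
      ((ContinuousLinearEquiv.isOpen (E := E) (F := F)).mem_nhds ?_))
    exact ⟨e, he.fderiv.symm⟩
  -- Invertibility of the derivative persists near `a`, which makes the inverse smooth there.
  obtain ⟨U, hUs, hUo, haU⟩ := eventually_nhds_iff.1 hU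
  let Φ := (hg.contDiffAt.toOpenPartialHomeomorph g he (by simp)).restrOpen U hUo
  have hΦs : Φ.source ⊆ U := fun b hb => hb.2
  refine ⟨{ toPartialEquiv := Φ.toPartialEquiv
            open_source := Φ.open_source
            open_target := Φ.open_target
            contMDiffOn_toFun := contMDiffOn_iff_contDiffOn.2 fun b hb =>
              (hUs b (hΦs hb)).1.contDiffWithinAt
            contMDiffOn_invFun := contMDiffOn_iff_contDiffOn.2 fun y hy => ?_ },
    ⟨hg.contDiffAt.mem_toOpenPartialHomeomorph_source he (by simp), haU⟩, fun _ _ => rfl⟩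
  have hb : Φ.symm y ∈ U := hΦs (Φ.map_target hy)
  obtain ⟨h1, e', he'⟩ := hUs _ hb
  have h2 : HasFDerivAt g (e' : E →L[ℝ] F) (Φ.symm y) := by
    rw [he']
    exact (h1.differentiableAt (by simp)).hasFDerivAt
  exact (Φ.contDiffAt_symm hy h2 h1).contDiffWithinAt

theorem isLocalDiffeomorphAt_of_injective [FiniteDimensional ℝ E]
    [FiniteDimensional ℝ F] {g : E → F} {a : E} (hg : SmoothNear g a)
    (hdim : Module.finrank ℝ E = Module.finrank ℝ F)
    (hinj : ∀ v, fderiv ℝ g a v = 0 → v = 0) :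
    IsLocalDiffeomorphAt 𝓘(ℝ, E) 𝓘(ℝ, F) ∞ g a := by
  have : CompleteSpace E := FiniteDimensional.complete ℝ E
  have hi : Function.Injective (fderiv ℝ g a : E →ₗ[ℝ] F) := by
    rw [← LinearMap.ker_eq_bot, LinearMap.ker_eq_bot']
    exact hinj
  refine isLocalDiffeomorphAt_of_smoothNear hg
    (LinearEquiv.ofInjectiveOfFinrankEq _ hi hdim).toContinuousLinearEquiv ?_
  exact hg.differentiableAt.hasFDerivAt.congr_fderiv (ContinuousLinearMap.ext fun v => rfl)

end LocalDiffeo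

namespace HasRelativeDegreeAt

variable {S : Type*} [NormedAddCommGroup S] [NormedSpace ℝ S]
  {F : S × Input → S} {y : S × Input → Fin 2 → ℝ} {ρ : Fin 2 → ℕ} {a : S × Input}

/-- The derivatives of order less than `ρ l` are functions of the state alone. -/
theorem eventually_eq_frozen (h : HasRelativeDegreeAt F y ρ a) (l : Fin 2) {i : ℕ}
    (hi : i < ρ l) : ∀ᶠ q in 𝓝 a, frozenDeriv F (fun b => y b l) i q =
      frozenDeriv F (fun b => y b l) i (q.1, a.2) := by
  obtain ⟨ε, hε, hball⟩ := Metric.eventually_nhds_iff_ball.1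
    ((h.smooth_frozenDeriv l i).and (h.input_free l i hi))
  filter_upwards [Metric.ball_mem_nhds a hε] with q hq
  rw [← ball_prod_same] at hq hball
  have hd : ∀ w ∈ Metric.ball a.2 ε, HasFDerivAt
      (fun w => frozenDeriv F (fun b => y b l) i (q.1, w)) (0 : Input →L[ℝ] ℝ) w := by
    intro w hw
    obtain ⟨h1, h2⟩ := hball (q.1, w) ⟨hq.1, hw⟩
    have h3 := HasFDerivAt.comp (g := frozenDeriv F (fun b => y b l) i) w
      (h1.differentiableAt (by simp)).hasFDerivAt (hasFDerivAt_prodMk_right q.1 w)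
    exact h3.congr_fderiv (ContinuousLinearMap.ext h2)
  exact (Metric.isOpen_ball).is_const_of_fderiv_eq_zero
    (convex_ball a.2 ε).isPreconnected
    (fun w hw => (hd w hw).differentiableAt.differentiableWithinAt)
    (fun w hw => (hd w hw).fderiv) hq.2 (Metric.mem_ball_self hε)

/-- The new state consists of the derivatives of `y l` of order less than `ρ l`. They do not depend
on the input near `a`, which is therefore frozen at its value at `a`. -/
def brunovskyState (F : S × Input → S) (y : S × Input → Fin 2 → ℝ) (ρ : Fin 2 → ℕ)
    (a : S × Input) (z : S) (l : Fin 2) (i : Fin (ρ l)) : ℝ :=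
  frozenDeriv F (fun b => y b l) i (z, a.2)

/-- The new input consists of the derivatives of `y l` of order `ρ l`. -/
def brunovskyInput (F : S × Input → S) (y : S × Input → Fin 2 → ℝ) (ρ : Fin 2 → ℕ)
    (q : S × Input) : Input :=
  fun l => frozenDeriv F (fun b => y b l) (ρ l) q

theorem eventually_brunovskyChain (h : HasRelativeDegreeAt F y ρ a) :
    ∀ᶠ q in 𝓝 a, ∀ (l : Fin 2) (i : Fin (ρ l + 1)),
      brunovskyChain (brunovskyState F y ρ a) (brunovskyInput F y ρ) q l i =
        frozenDeriv F (fun b => y b l) i q := by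
  refine eventually_all.2 fun l => eventually_all.2 fun i => ?_
  refine Fin.lastCases ?_ (fun i => ?_) i
  · exact Eventually.of_forall fun q => by simp [brunovskyChain, brunovskyInput]
  · filter_upwards [h.eventually_eq_frozen l i.2] with q hq
    simp [brunovskyChain, brunovskyState, hq]

theorem smoothNear_brunovskyState (h : HasRelativeDegreeAt F y ρ a) :
    SmoothNear (brunovskyState F y ρ a) a.1 := by
  refine SmoothNear.pi fun l => SmoothNear.pi fun i => ?_
  exact SmoothNear.comp (g := frozenDeriv F (fun b => y b l) i) (k := fun z => (z, a.2))
    (h.smooth_frozenDeriv l i) (ContDiff.smoothNear (by fun_prop) _)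

theorem fderiv_brunovskyState {z : S} (l : Fin 2) (i : Fin (ρ l)) (v : S)
    (hs : DifferentiableAt ℝ (brunovskyState F y ρ a) z)
    (hz : DifferentiableAt ℝ (frozenDeriv F (fun b => y b l) i) (z, a.2)) :
    fderiv ℝ (brunovskyState F y ρ a) z v l i =
      fderiv ℝ (frozenDeriv F (fun b => y b l) i) (z, a.2) (v, 0) := by
  have h1 : HasFDerivAt (fun z => brunovskyState F y ρ a z l i)
      ((ContinuousLinearMap.proj (R := ℝ) (φ := fun _ : Fin (ρ l) => ℝ) i).comp
        ((ContinuousLinearMap.proj (R := ℝ) (φ := fun l : Fin 2 => Fin (ρ l) → ℝ) l).comp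
          (fderiv ℝ (brunovskyState F y ρ a) z))) z :=
    hasFDerivAt_pi'.1 (hasFDerivAt_pi'.1 hs.hasFDerivAt l) i
  have h2 := HasFDerivAt.comp (g := frozenDeriv F (fun b => y b l) i) z hz.hasFDerivAt
    (hasFDerivAt_prodMk_left (𝕜 := ℝ) z a.2)
  exact DFunLike.congr_fun (h1.unique h2) v

theorem smoothNear_brunovskyInput (h : HasRelativeDegreeAt F y ρ a) :
    SmoothNear (brunovskyInput F y ρ) a :=
  SmoothNear.pi fun l => h.smooth_frozenDeriv l (ρ l)

variable [FiniteDimensional ℝ S]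

/-- A system with a vector relative degree whose sum is the dimension of the state is taken to
Brunovský normal form by its outputs and their derivatives. -/
theorem isBrunovskyTransformationAt (h : HasRelativeDegreeAt F y ρ a)
    (hρ : ρ 0 + ρ 1 = Module.finrank ℝ S) :
    IsBrunovskyTransformationAt F ρ (brunovskyState F y ρ a) (brunovskyInput F y ρ) a := by
  have hS := h.smoothNear_brunovskyState
  have hI := h.smoothNear_brunovskyInput
  have hdim : Module.finrank ℝ S = Module.finrank ℝ ((j : Fin 2) → Fin (ρ j) → ℝ) := by
    simp [Module.finrank_pi_fintype, hρ]
  have hSc := SmoothNear.comp (g := brunovskyState F y ρ a) (k := fun q : S × Input => q.1) hS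
    (smoothNear_fst a)
  have hΦd : ∀ v, fderiv ℝ (fun q : S × Input => (brunovskyState F y ρ a q.1,
      brunovskyInput F y ρ q)) a v =
        (fderiv ℝ (brunovskyState F y ρ a) a.1 v.1, fderiv ℝ (brunovskyInput F y ρ) a v) := by
    intro v
    have h1 : HasFDerivAt (fun q : S × Input => brunovskyState F y ρ a q.1) _ a :=
      HasFDerivAt.comp (g := brunovskyState F y ρ a) a hS.differentiableAt.hasFDerivAt
        hasFDerivAt_fst
    rw [hSc.differentiableAt.fderiv_prodMk hI.differentiableAt, h1.fderiv]
    rfl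
  have hstate : ∀ v l (i : Fin (ρ l)), fderiv ℝ (brunovskyState F y ρ a) a.1 v l i =
      fderiv ℝ (frozenDeriv F (fun b => y b l) i) a (v, 0) := fun v l i =>
    fderiv_brunovskyState l i v hS.differentiableAt (h.smooth_frozenDeriv l i).differentiableAt
  have hinput : ∀ v l, fderiv ℝ (brunovskyInput F y ρ) a v l =
      fderiv ℝ (frozenDeriv F (fun b => y b l) (ρ l)) a v := by
    intro v l
    have := fderiv_pi (𝕜 := ℝ) (φ := fun l => frozenDeriv F (fun b => y b l) (ρ l)) (x := a)
      fun l => (h.smooth_frozenDeriv l (ρ l)).differentiableAt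
    rw [show brunovskyInput F y ρ = fun q l => frozenDeriv F (fun b => y b l) (ρ l) q from rfl,
      this]
    rfl
  have hinj : ∀ v : S × Input, fderiv ℝ (brunovskyState F y ρ a) a.1 v.1 = 0 →
      fderiv ℝ (brunovskyInput F y ρ) a v = 0 → v = 0 := by
    intro v h1 h2
    refine h.eq_zero_of_fderiv_eq_zero hρ fun l i hi => ?_
    rcases hi.lt_or_eq with hlt | rfl
    · have h3 := hstate v.1 l ⟨i, hlt⟩
      have h4 := (h.input_free l i hlt).self_of_nhds v.2
      have h5 : v = (v.1, 0) + (0, v.2) := by simp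
      rw [h5, map_add, h4, ← h3, h1]
      simp
    · rw [← hinput, h2]
      rfl
  refine ⟨hρ, isLocalDiffeomorphAt_of_injective hS hdim fun v hv => ?_,
    isLocalDiffeomorphAt_of_injective (hSc.prodMk hI) ?_ fun v hv => ?_, ?_⟩
  · -- The input can be chosen so that it compensates the effect of `v` on the new input.
    obtain ⟨w, hw⟩ := h.exists_input (-fderiv ℝ (brunovskyInput F y ρ) a (v, 0))
    have h1 : ((v, w) : S × Input) = 0 := by
      refine hinj _ hv (funext fun l => ?_)
      have h5 : ((v, w) : S × Input) = (v, 0) + (0, w) := by simp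
      rw [h5, map_add, Pi.add_apply, hinput (0, w), hw]
      simp
    exact congrArg Prod.fst h1
  · rw [Module.finrank_prod, Module.finrank_prod, hdim]
  · rw [hΦd] at hv
    exact hinj v (congrArg Prod.fst hv) (congrArg Prod.snd hv)
  · have hfst : Tendsto (fun q : S × Input => (q.1, a.2)) (𝓝 a) (𝓝 a) := by
      have : Continuous fun q : S × Input => (q.1, a.2) := by fun_prop
      simpa using this.tendsto a
    have hall : ∀ l (i : Fin (ρ l)), ∀ᶠ q in 𝓝 a,
        fderiv ℝ (brunovskyState F y ρ a) q.1 (F q) l i =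
          fderiv ℝ (frozenDeriv F (fun b => y b l) i) q (F q, 0) := by
      intro l i
      filter_upwards [hfst.eventually (h.smooth_frozenDeriv l i),
        (continuous_fst.tendsto a).eventually hS,
        eventually_eventually_nhds.2 (h.eventually_eq_frozen l i.2)] with q h1 h2 h3
      rw [fderiv_brunovskyState l i _ (h2.differentiableAt (by simp))
        (h1.differentiableAt (by simp))]
      have h4 : frozenDeriv F (fun b => y b l) i =ᶠ[𝓝 q]
          fun q => frozenDeriv F (fun b => y b l) i (q.1, a.2) := h3
      have h5 : HasFDerivAt (fun q : S × Input => (q.1, a.2))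
          ((ContinuousLinearMap.fst ℝ S Input).prod 0) q :=
        hasFDerivAt_fst.prodMk (hasFDerivAt_const _ _)
      have h6 : HasFDerivAt (fun q : S × Input =>
          frozenDeriv F (fun b => y b l) i (q.1, a.2)) _ q :=
        HasFDerivAt.comp (g := frozenDeriv F (fun b => y b l) i) q
          (h1.differentiableAt (by simp)).hasFDerivAt h5
      rw [h4.fderiv_eq, h6.fderiv]
      rfl
    filter_upwards [h.eventually_brunovskyChain,
      eventually_all.2 fun l => eventually_all.2 (hall l)] with q h1 h2 l i
    rw [h2, h1]
    rfl

theorem isLinearizingOutputAt (h : HasRelativeDegreeAt F y ρ a)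
    (hρ : ρ 0 + ρ 1 = Module.finrank ℝ S) : IsLinearizingOutputAt F y a := by
  refine ⟨ρ, _, _, h.isBrunovskyTransformationAt hρ, ?_⟩
  filter_upwards [h.eventually_brunovskyChain] with q hq l
  rw [hq]
  rfl

end HasRelativeDegreeAt

/-! ### Infinitesimal flatness and partial derivatives of the outputs -/

section Flat

variable {E F : Type*} [NormedAddCommGroup E] [NormedSpace ℝ E]
  [NormedAddCommGroup F] [NormedSpace ℝ F]

/-- The linearization of flatness at the jet `p`: a tangent vector that is annihilated by the
differentials of the output and its derivatives up to order `r` has no component along `(x, u)`. -/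
def IsInfinitesimallyFlatAt (f : E × Input → E) (φ : E × Input → Fin 2 → ℝ) (r : ℕ)
    (p : Jet E) : Prop :=
  ∀ v : Jet E, (∀ i ≤ r, ∀ l, lineDeriv ℝ (outputDeriv f (fun b => φ b l) i) p v = 0) →
    v.1 = 0 ∧ v.2 0 = 0

theorem lineDeriv_outputDeriv_apply {f : E × Input → E} {φ : E × Input → Fin 2 → ℝ} {p : Jet E}
    (hf : SmoothNear f (p.1, p.2 0)) (hφ : SmoothNear φ (p.1, p.2 0)) (l : Fin 2) (i : ℕ)
    (v : Jet E) : lineDeriv ℝ (outputDeriv f (fun b => φ b l) i) p v =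
      lineDeriv ℝ (outputDeriv f φ i) p v l := by
  rw [lineDeriv_congr_nhds (outputDeriv_apply hf hφ l i),
    (jetSmoothAt_outputDeriv hf hφ i).lineDeriv_apply]

theorem SmoothNear.apply_output {φ : E → Fin 2 → ℝ} {a : E} (h : SmoothNear φ a)
    (l : Fin 2) : SmoothNear (fun b => φ b l) a :=
  SmoothNear.comp (g := fun z : Fin 2 → ℝ => z l) (ContDiff.smoothNear (by fun_prop) _) h

theorem IsFlatOutputAt.exists_isInfinitesimallyFlatAt {f : E × Input → E}
    {φ : E × Input → Fin 2 → ℝ} {p : Jet E} (h : IsFlatOutputAt f φ p)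
    (hf : SmoothNear f (p.1, p.2 0)) : ∃ r, IsInfinitesimallyFlatAt f φ r p := by
  obtain ⟨hφ, r, Fx, Fu, hFx, hFu, he⟩ := h
  refine ⟨r, fun v hv => ?_⟩
  have hv' : ∀ i ≤ r, lineDeriv ℝ (outputDeriv f φ i) p v = 0 := fun i hi =>
    funext fun l => by rw [← lineDeriv_outputDeriv_apply hf hφ, hv i hi]; rfl
  have hsm : ∀ i ≤ r, JetSmoothAt (r + 1) (outputDeriv f φ i) p := fun i hi =>
    (jetSmoothAt_outputDeriv hf hφ i).mono (by omega)
  have key : ∀ N ≤ r + 1, JetSmoothAt (r + 1) (fun q (i : Fin N) => outputDeriv f φ i q) p ∧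
      lineDeriv ℝ (fun q (i : Fin N) => outputDeriv f φ i q) p v = 0 := by
    intro N hN
    have h1 : ∀ i : Fin N, JetSmoothAt (r + 1) (outputDeriv f φ i) p := fun i =>
      hsm i (by omega)
    refine ⟨JetSmoothAt.pi h1, ?_⟩
    rw [JetSmoothAt.lineDeriv_pi h1]
    exact funext fun i => hv' i (by omega)
  obtain ⟨hx1, hx2⟩ := key r (by omega)
  obtain ⟨hu1, hu2⟩ := key (r + 1) le_rfl
  have hx : (fun q : Jet E => q.1) =ᶠ[𝓝 p] fun q => Fx (fun i : Fin r => outputDeriv f φ i q) :=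
    he.mono fun q hq => hq.1
  have hu : (fun q : Jet E => q.2 0) =ᶠ[𝓝 p]
      fun q => Fu (fun i : Fin (r + 1) => outputDeriv f φ i q) := he.mono fun q hq => hq.2
  constructor
  · rw [← lineDeriv_jet_fst p v, lineDeriv_congr_nhds hx,
      JetSmoothAt.lineDeriv_comp (g := fun q (i : Fin r) => outputDeriv f φ i q) hFx hx1, hx2,
      map_zero]
  · rw [← lineDeriv_jet_snd 0 p v, lineDeriv_congr_nhds hu,
      JetSmoothAt.lineDeriv_comp (g := fun q (i : Fin (r + 1)) => outputDeriv f φ i q) hFu hu1,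
      hu2, map_zero]

/-- Infinitesimal flatness is invariant under changes of the input. -/
theorem IsInfinitesimallyFlatAt.comp_input {f f' : E × Input → E} {φ : E × Input → Fin 2 → ℝ}
    {h : E × Input → Input} {r : ℕ} {p : Jet E}
    (hflat : IsInfinitesimallyFlatAt f φ r (jetMap f' h p))
    (hf' : SmoothNear f' (p.1, p.2 0)) (hh : SmoothNear h (p.1, p.2 0))
    (hf : SmoothNear f (p.1, h (p.1, p.2 0)))
    (hff' : ∀ᶠ b in 𝓝 (p.1, p.2 0), f (b.1, h b) = f' b)
    (hφ : SmoothNear φ (p.1, h (p.1, p.2 0)))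
    (hinj : ∀ w : Input, fderiv ℝ h (p.1, p.2 0) (0, w) = 0 → w = 0) :
    IsInfinitesimallyFlatAt f' (fun b => φ (b.1, h b)) r p := by
  intro v hv
  have h1 := hflat (v.1, fun i => lineDeriv ℝ (outputDeriv f' h i) p v) fun i hi l => by
    rw [← lineDeriv_comp_jetMap hf' hh (jetSmoothAt_outputDeriv (p := jetMap f' h p) hf
      (hφ.apply_output l) i),
      lineDeriv_congr_nhds (outputDeriv_jetMap hf' hh hf hff' (hφ.apply_output l) i)]
    exact hv i hi l
  refine ⟨h1.1, hinj _ ?_⟩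
  have h2 := h1.2
  have h3 : JetSmoothAt 1 (fun q : Jet E => (q.1, q.2 0)) p :=
    (JetSmoothAt.fst p).prodMk (JetSmoothAt.snd one_pos p)
  have h4 := JetSmoothAt.lineDeriv_comp (g := fun q : Jet E => (q.1, q.2 0)) hh h3 v
  rw [(JetSmoothAt.fst p).lineDeriv_prodMk (JetSmoothAt.snd one_pos p), lineDeriv_jet_fst,
    lineDeriv_jet_snd, show v.1 = 0 from h1.1] at h4
  rw [← h4]
  exact h2

/-- The tangent vector of jets with the component `w` along `u^(m)` and no other components. -/
def jetDir {E : Type*} [Zero E] (m : ℕ) (w : Input) : Jet E := (0, Pi.single m w)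

theorem jetDir_snd {E : Type*} [Zero E] (m i : ℕ) (w : Input) (c : Fin 2) :
    (jetDir m w : Jet E).2 i c = if i = m then w c else 0 := by
  by_cases h : i = m
  · subst h; simp [jetDir]
  · simp [jetDir, h]

theorem JetSmoothAt.jetSmoothAt_lineDeriv {N : ℕ} {g : Jet E → F} {p : Jet E} (h : JetSmoothAt N g p)
    (v : Jet E) : JetSmoothAt N (fun q => lineDeriv ℝ g q v) p := by
  obtain ⟨g', hg', he⟩ := h
  refine ⟨fun y => fderiv ℝ g' y (jetTrunc N v), hg'.fderiv.clm_apply (smoothNear_const _ _), ?_⟩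
  filter_upwards [(jetTrunc N).continuous.continuousAt.eventually hg'.eventually,
    eventually_eventually_nhds.2 he] with q h1 h2
  exact lineDeriv_eq_fderiv_of_trunc h1 h2 v

theorem JetSmoothAt.lineDeriv_jetDir_eq_zero {N : ℕ} {g : Jet E → F} {p : Jet E}
    (h : JetSmoothAt N g p) {m : ℕ} (hm : N ≤ m) (w : Input) :
    lineDeriv ℝ g p (jetDir m w) = 0 := by
  refine h.lineDeriv_eq_zero (Prod.ext rfl (funext fun i => funext fun c => ?_))
  have hi : (i : ℕ) ≠ m := by omega
  exact (jetDir_snd (E := E) m i w c).trans (if_neg hi)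

/-- If `g` does not involve `u^(m+1)` in the direction `w`, then the coefficient of `u^(m+1)` in its
total derivative is that of `u^(m)` in `g`. -/
theorem JetSmoothAt.lineDeriv_totalDeriv_jetDir {f : E × Input → E} {N : ℕ} {g : Jet E → F}
    {p : Jet E} (h : JetSmoothAt N g p) (hf : SmoothNear f (p.1, p.2 0)) {m : ℕ} {w : Input}
    (h0 : ∀ᶠ q in 𝓝 p, lineDeriv ℝ g q (jetDir (m + 1) w) = 0) :
    lineDeriv ℝ (_root_.totalDeriv f g) p (jetDir (m + 1) w) = lineDeriv ℝ g p (jetDir m w) := by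
  have h1 : _root_.totalDeriv f (fun q => lineDeriv ℝ g q (jetDir (m + 1) w)) p = 0 := by
    have h2 : (fun q => lineDeriv ℝ g q (jetDir (m + 1) w)) =ᶠ[𝓝 p] fun _ => 0 := h0
    rw [(totalDeriv_congr_nhds h2).self_of_nhds, _root_.totalDeriv]
    simp [lineDeriv]
  rw [h.lineDeriv_totalDeriv hf, h1, zero_add]
  congr 1
  refine Prod.ext ?_ (funext fun i => funext fun c => ?_)
  · change fderiv ℝ f (p.1, p.2 0) (0, (Pi.single (m + 1) w : ℕ → Input) 0) = 0
    rw [Pi.single_eq_of_ne (Nat.succ_ne_zero m).symm]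
    exact map_zero _
  · change (jetDir (m + 1) w : Jet E).2 (i + 1) c = (jetDir m w : Jet E).2 i c
    simp [jetDir_snd]

/-- If the derivatives of `z` of order less than `s` do not involve the input in the direction `w`,
then the derivative of order `s + t` involves it up to order `t`, and its partial derivative in the
top order does not depend on `t`. -/
theorem lineDeriv_outputDeriv_add {f : E × Input → E} {z : E × Input → ℝ} {p : Jet E}
    (hf : SmoothNear f (p.1, p.2 0)) (hz : SmoothNear z (p.1, p.2 0)) {s : ℕ} {w : Input}
    (hfree : ∀ i < s, ∀ᶠ q in 𝓝 p, ∀ m, lineDeriv ℝ (outputDeriv f z i) q (jetDir m w) = 0)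
    (t : ℕ) : ∀ᶠ q in 𝓝 p,
      (∀ m, t < m → lineDeriv ℝ (outputDeriv f z (s + t)) q (jetDir m w) = 0) ∧
      lineDeriv ℝ (outputDeriv f z (s + t)) q (jetDir t w) =
        lineDeriv ℝ (outputDeriv f z s) q (jetDir 0 w) := by
  have hsm : ∀ i, ∀ᶠ q in 𝓝 p, JetSmoothAt (i + 1) (outputDeriv f z i) q := fun i =>
    (jetSmoothAt_outputDeriv hf hz i).eventually
  have hfe := continuous_jet_base.continuousAt.eventually hf.eventually
  induction t with
  | zero =>
    cases s with
    | zero =>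
      filter_upwards [hsm 0] with q hq
      exact ⟨fun m hm => hq.lineDeriv_jetDir_eq_zero hm w, rfl⟩
    | succ s =>
      filter_upwards [hsm s, hfe, eventually_eventually_nhds.2 (hfree s (by omega))]
        with q h1 h2 h3
      refine ⟨fun m hm => ?_, rfl⟩
      obtain ⟨m, rfl⟩ : ∃ m', m = m' + 1 := ⟨m - 1, by omega⟩
      rw [Nat.add_zero, outputDeriv_succ,
        h1.lineDeriv_totalDeriv_jetDir h2 (h3.mono fun q' hq' => hq' _)]
      exact h3.self_of_nhds m
  | succ t ih =>
    filter_upwards [hsm (s + t), hfe, eventually_eventually_nhds.2 ih] with q h1 h2 h3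
    have key : ∀ m, t ≤ m → lineDeriv ℝ (outputDeriv f z (s + (t + 1))) q (jetDir (m + 1) w) =
        lineDeriv ℝ (outputDeriv f z (s + t)) q (jetDir m w) := by
      intro m hm
      rw [← Nat.add_assoc, outputDeriv_succ]
      exact h1.lineDeriv_totalDeriv_jetDir h2 (h3.mono fun q' hq' => hq'.1 _ (by omega))
    refine ⟨fun m hm => ?_, ?_⟩
    · obtain ⟨m, rfl⟩ : ∃ m', m = m' + 1 := ⟨m - 1, by omega⟩
      rw [key m (by omega)]
      exact h3.self_of_nhds.1 m (by omega)
    · rw [key t le_rfl]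
      exact h3.self_of_nhds.2

theorem outputDeriv_add_of_eq_input {f : E × Input → E} {y : E × Input → ℝ} {p : Jet E}
    {k : ℕ} (hk : ∀ᶠ q in 𝓝 p, outputDeriv f y k q = q.2 0 0) (t : ℕ) :
    ∀ᶠ q in 𝓝 p, outputDeriv f y (k + t) q = q.2 t 0 := by
  induction t with
  | zero => exact hk
  | succ t ih =>
    rw [← Nat.add_assoc, outputDeriv_succ]
    filter_upwards [totalDeriv_congr_nhds (f := f) ih] with q hq
    rw [hq, totalDeriv, (JetSmoothAt.snd (Nat.lt_succ_self t) q).lineDeriv_apply,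
      lineDeriv_jet_snd]
    rfl

end Flat

/-! ### Systems whose first input is a derivative of an output -/

section Normalized

variable {E : Type*} [NormedAddCommGroup E] [NormedSpace ℝ E]

/-- The `k`-th derivative of the output component `j` is the first input, and the lower ones do not
depend on the input. -/
structure HasInputOutputAt (f : E × Input → E) (φ : E × Input → Fin 2 → ℝ) (j : Fin 2) (k : ℕ)
    (p : Jet E) : Prop where
  smooth_field : SmoothNear f (p.1, p.2 0)
  smooth_output : SmoothNear φ (p.1, p.2 0)
  eq_input : ∀ᶠ q in 𝓝 p, outputDeriv f (fun b => φ b j) k q = q.2 0 0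
  input_free : ∀ i < k, ∀ᶠ q in 𝓝 p, ∀ υ : ℕ → Input,
    lineDeriv ℝ (outputDeriv f (fun b => φ b j) i) q (0, υ) = 0

namespace HasInputOutputAt

variable {f : E × Input → E} {φ : E × Input → Fin 2 → ℝ} {j : Fin 2} {k : ℕ} {p : Jet E}

theorem eventually (h : HasInputOutputAt f φ j k p) :
    ∀ᶠ q in 𝓝 p, HasInputOutputAt f φ j k q := by
  have hfree : ∀ᶠ q in 𝓝 p, ∀ i : Fin k, ∀ᶠ q' in 𝓝 q, ∀ υ : ℕ → Input,
      lineDeriv ℝ (outputDeriv f (fun b => φ b j) i) q' (0, υ) = 0 :=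
    eventually_all.2 fun i => eventually_eventually_nhds.2 (h.input_free i i.2)
  filter_upwards [continuous_jet_base.continuousAt.eventually h.smooth_field.eventually,
    continuous_jet_base.continuousAt.eventually h.smooth_output.eventually,
    eventually_eventually_nhds.2 h.eq_input, hfree] with q h1 h2 h3 h4
  exact ⟨h1, h2, h3, fun i hi => h4 ⟨i, hi⟩⟩

theorem jetSmoothAt (h : HasInputOutputAt f φ j k p) (l : Fin 2) (i : ℕ) :
    JetSmoothAt (i + 1) (outputDeriv f (fun b => φ b l) i) p :=
  jetSmoothAt_outputDeriv h.smooth_field (h.smooth_output.apply_output l) i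

theorem lineDeriv_add (h : HasInputOutputAt f φ j k p) (t : ℕ) :
    ∀ᶠ q in 𝓝 p, ∀ v, lineDeriv ℝ (outputDeriv f (fun b => φ b j) (k + t)) q v = v.2 t 0 := by
  filter_upwards [lineDeriv_congr_nhds_eventually (outputDeriv_add_of_eq_input h.eq_input t)]
    with q hq v
  rw [hq, (JetSmoothAt.snd (Nat.lt_succ_self t) q).lineDeriv_apply, lineDeriv_jet_snd]

theorem lineDeriv_snd_input (h : HasInputOutputAt f φ j k p) (i m : ℕ) :
    ∀ᶠ q in 𝓝 p,
      lineDeriv ℝ (outputDeriv f (fun b => φ b j) i) q (jetDir m (Pi.single 1 1)) = 0 := by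
  rcases lt_or_ge i k with hi | hi
  · filter_upwards [h.input_free i hi] with q hq
    exact hq _
  · obtain ⟨t, rfl⟩ := Nat.exists_eq_add_of_le hi
    filter_upwards [h.lineDeriv_add t] with q hq
    rw [hq, jetDir_snd]
    simp

end HasInputOutputAt

/-- In addition, the `s`-th derivative of the other component `j'` is the first one that depends on
the second input. -/
structure IsNormalizedAt (f : E × Input → E) (φ : E × Input → Fin 2 → ℝ) (j j' : Fin 2)
    (k s : ℕ) (p : Jet E) : Prop extends HasInputOutputAt f φ j k p where
  ne : j ≠ j'
  snd_input_free : ∀ i < s, ∀ᶠ q in 𝓝 p, ∀ m,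
    lineDeriv ℝ (outputDeriv f (fun b => φ b j') i) q (jetDir m (Pi.single 1 1)) = 0
  snd_input_ne : lineDeriv ℝ (outputDeriv f (fun b => φ b j') s) p (jetDir 0 (Pi.single 1 1)) ≠ 0

namespace IsNormalizedAt

variable {f : E × Input → E} {φ : E × Input → Fin 2 → ℝ} {j j' : Fin 2} {k s : ℕ} {p : Jet E}

theorem eventually (h : IsNormalizedAt f φ j j' k s p) :
    ∀ᶠ q in 𝓝 p, IsNormalizedAt f φ j j' k s q := by
  have hfree : ∀ᶠ q in 𝓝 p, ∀ i : Fin s, ∀ᶠ q' in 𝓝 q, ∀ m,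
      lineDeriv ℝ (outputDeriv f (fun b => φ b j') i) q' (jetDir m (Pi.single 1 1)) = 0 :=
    eventually_all.2 fun i => eventually_eventually_nhds.2 (h.snd_input_free i i.2)
  filter_upwards [h.toHasInputOutputAt.eventually, hfree,
    ((h.jetSmoothAt j' s).jetSmoothAt_lineDeriv (jetDir 0 (Pi.single 1 1))).continuousAt.eventually_ne
      h.snd_input_ne] with q h1 h2 h3
  exact ⟨h1, h.ne, fun i hi => h2 ⟨i, hi⟩, h3⟩

theorem eq_or_eq (h : IsNormalizedAt f φ j j' k s p) (l : Fin 2) : l = j ∨ l = j' := by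
  have := h.ne
  omega

/-- A tangent vector `ξ` of the state that is annihilated by the differentials of the derivatives
of `φ j` of order less than `k` and of `φ j'` of order less than `s` extends to a tangent vector of
jets that is annihilated by the differentials of arbitrarily many derivatives of the output: the
derivatives of the first input are kept fixed, and those of the second input are determined one
after the other. Flatness then forces `ξ = 0`. -/
theorem finrank_le [FiniteDimensional ℝ E] (h : IsNormalizedAt f φ j j' k s p) {r : ℕ}
    (hflat : IsInfinitesimallyFlatAt f φ r p) : Module.finrank ℝ E ≤ k + s := by
  by_contra! hlt
  let A : E →ₗ[ℝ] (Fin k → ℝ) × (Fin s → ℝ) :=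
    { toFun := fun ξ => (fun i => lineDeriv ℝ (outputDeriv f (fun b => φ b j) i) p (ξ, 0),
        fun i => lineDeriv ℝ (outputDeriv f (fun b => φ b j') i) p (ξ, 0))
      map_add' := fun ξ η => by
        have : ((ξ + η, 0) : Jet E) = (ξ, 0) + (η, 0) := by simp
        rw [this]
        exact Prod.ext (funext fun i => (h.jetSmoothAt j i).lineDeriv_add _ _)
          (funext fun i => (h.jetSmoothAt j' i).lineDeriv_add _ _)
      map_smul' := fun c ξ => by
        have : ((c • ξ, 0) : Jet E) = c • (ξ, 0) := by simp
        rw [this]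
        exact Prod.ext (funext fun i => (h.jetSmoothAt j i).lineDeriv_smul _ _)
          (funext fun i => (h.jetSmoothAt j' i).lineDeriv_smul _ _) }
  have hA : LinearMap.ker A ≠ ⊥ := LinearMap.ker_ne_bot_of_finrank_lt (by simpa using hlt)
  obtain ⟨ξ, hξ, hξ0⟩ := (Submodule.ne_bot_iff _).1 hA
  rw [LinearMap.mem_ker] at hξ
  have hb := h.snd_input_ne
  set b := lineDeriv ℝ (outputDeriv f (fun b => φ b j') s) p (jetDir 0 (Pi.single 1 1)) with hbdef
  have main : ∀ M : ℕ, ∃ v : Jet E, v.1 = ξ ∧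
      (∀ i, lineDeriv ℝ (outputDeriv f (fun b => φ b j) i) p v = 0) ∧
      ∀ i < s + M, lineDeriv ℝ (outputDeriv f (fun b => φ b j') i) p v = 0 := by
    intro M
    induction M with
    | zero =>
      refine ⟨(ξ, 0), rfl, fun i => ?_, fun i hi => ?_⟩
      · rcases lt_or_ge i k with hi | hi
        · exact congrFun (congrArg Prod.fst hξ) ⟨i, hi⟩
        · obtain ⟨t, rfl⟩ := Nat.exists_eq_add_of_le hi
          rw [(h.lineDeriv_add t).self_of_nhds]
          rfl
      · exact congrFun (congrArg Prod.snd hξ) ⟨i, hi⟩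
    | succ M ih =>
      obtain ⟨v, hv1, hv2, hv3⟩ := ih
      -- The correction acts on the derivative of order `s + M` through the factor `b`, and does
      -- not affect the derivatives of lower order.
      let c := -lineDeriv ℝ (outputDeriv f (fun b => φ b j') (s + M)) p v / b
      refine ⟨v + c • jetDir M (Pi.single 1 1), ?_, fun i => ?_, fun i hi => ?_⟩
      · simp [hv1, jetDir]
      · rw [(h.jetSmoothAt j i).lineDeriv_add, (h.jetSmoothAt j i).lineDeriv_smul, hv2,
          (h.lineDeriv_snd_input i M).self_of_nhds]
        simp
      · rw [(h.jetSmoothAt j' i).lineDeriv_add, (h.jetSmoothAt j' i).lineDeriv_smul]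
        have htop := fun t => (lineDeriv_outputDeriv_add h.smooth_field
          (h.smooth_output.apply_output j') h.snd_input_free t).self_of_nhds
        rcases lt_or_ge i s with his | his
        · rw [hv3 i (by omega), (h.snd_input_free i his).self_of_nhds]
          simp
        · obtain ⟨t, rfl⟩ := Nat.exists_eq_add_of_le his
          rcases lt_or_ge t M with ht | ht
          · rw [hv3 _ (by omega), (htop t).1 M ht]
            simp
          · obtain rfl : t = M := by omega
            rw [(htop t).2, ← hbdef, smul_eq_mul, div_mul_cancel₀ _ hb, add_neg_cancel]
  obtain ⟨v, hv1, hv2, hv3⟩ := main (r + 1)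
  refine hξ0 (hv1 ▸ (hflat v fun i hi l => ?_).1)
  rcases h.eq_or_eq l with rfl | rfl
  · exact hv2 i
  · exact hv3 i (by omega)

end IsNormalizedAt

end Normalized

/-! ### The prolonged system -/

section Prolonged

variable {E : Type*} [NormedAddCommGroup E] [NormedSpace ℝ E]

/-- The point `((x, u₁, …, u₁^(K-1)), (u₁^(K), u₂))` of the `K`-fold prolonged system below a
jet. -/
def prolongedProj (K : ℕ) : Jet E →L[ℝ] (E × (Fin K → ℝ)) × Input where
  toFun p := ((p.1, fun i : Fin K => p.2 i 0), ![p.2 K 0, p.2 0 1])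
  map_add' p q := by
    refine Prod.ext rfl (funext fun c => ?_)
    fin_cases c <;> rfl
  map_smul' c p := by
    refine Prod.ext rfl (funext fun c => ?_)
    fin_cases c <;> rfl
  cont := by fun_prop

theorem prolongedProj_apply (K : ℕ) (p : Jet E) :
    prolongedProj K p = ((p.1, fun i : Fin K => p.2 i 0), ![p.2 K 0, p.2 0 1]) := rfl

/-- A right inverse of `prolongedProj`, which sets the remaining coordinates to zero. -/
def prolongedLift (K : ℕ) (b : (E × (Fin K → ℝ)) × Input) : Jet E :=
  (b.1.1, fun m => ![if h : m < K then b.1.2 ⟨m, h⟩ else if m = K then b.2 0 else 0,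
    if m = 0 then b.2 1 else 0])

theorem prolongedProj_lift (K : ℕ) (b : (E × (Fin K → ℝ)) × Input) :
    prolongedProj K (prolongedLift K b) = b := by
  refine Prod.ext (Prod.ext rfl (funext fun i => ?_)) (funext fun c => ?_)
  · simp [prolongedProj_apply, prolongedLift]
  · fin_cases c <;> simp [prolongedProj_apply, prolongedLift]

theorem continuous_prolongedLift {E : Type*} [TopologicalSpace E] (K : ℕ) :
    Continuous (prolongedLift K : (E × (Fin K → ℝ)) × Input → Jet E) := by
  refine (by fun_prop : Continuous fun b : (E × (Fin K → ℝ)) × Input => b.1.1).prodMk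
    (continuous_pi fun m => continuous_pi fun c => ?_)
  fin_cases c
  · change Continuous fun b : (E × (Fin K → ℝ)) × Input =>
      if h : m < K then b.1.2 ⟨m, h⟩ else if m = K then b.2 0 else 0
    split_ifs <;> fun_prop
  · change Continuous fun b : (E × (Fin K → ℝ)) × Input => if m = 0 then b.2 1 else 0
    split_ifs <;> fun_prop

theorem prolongedLift_input (K : ℕ) (w : Input) :
    prolongedLift K ((0, w) : (E × (Fin K → ℝ)) × Input) =
      w 0 • jetDir K (Pi.single 0 1) + w 1 • jetDir 0 (Pi.single 1 1) := by
  refine Prod.ext (by simp [prolongedLift, jetDir]) (funext fun m => funext fun c => ?_)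
  simp only [prolongedLift, Prod.snd_add, Prod.smul_snd, Pi.add_apply, Pi.smul_apply, jetDir_snd]
  fin_cases c <;> simp
  intro h1 h2
  omega

/-- A property that holds at the jets near `p` holds at the points of the prolonged system near the
projection of `p`. -/
theorem eventually_of_prolongedProj {K : ℕ} {p : Jet E}
    {P : (E × (Fin K → ℝ)) × Input → Prop} (h : ∀ᶠ q in 𝓝 p, P (prolongedProj K q)) :
    ∀ᶠ b in 𝓝 (prolongedProj K p), P b := by
  have hc : Tendsto (fun b => p + (prolongedLift K b - prolongedLift K (prolongedProj K p)))
      (𝓝 (prolongedProj K p)) (𝓝 p) := by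
    have : Continuous fun b => p + (prolongedLift K b -
        prolongedLift K (prolongedProj K p)) :=
      continuous_const.add ((continuous_prolongedLift K).sub continuous_const)
    simpa using this.tendsto (prolongedProj K p)
  filter_upwards [hc.eventually h] with b hb
  rw [map_add, map_sub, prolongedProj_lift, prolongedProj_lift] at hb
  simpa using hb

theorem prolongedInput_proj {K : ℕ} (p : Jet E) (i : Fin (K + 1)) :
    prolongedInput (prolongedProj K p) i = p.2 i 0 := by
  refine Fin.lastCases ?_ (fun i => ?_) i <;> simp [prolongedInput, prolongedProj_apply]

theorem prolongedBase_proj {K : ℕ} (p : Jet E) :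
    prolongedBase (prolongedProj K p) = (p.1, p.2 0) := by
  refine Prod.ext rfl (funext fun c => ?_)
  fin_cases c
  · exact prolongedInput_proj p 0
  · rfl

theorem contDiff_prolongedInput {K : ℕ} (i : Fin (K + 1)) :
    ContDiff ℝ ∞ fun q : (E × (Fin K → ℝ)) × Input => prolongedInput q i := by
  refine Fin.lastCases ?_ (fun i => ?_) i <;> simp only [prolongedInput, Fin.snoc_last,
    Fin.snoc_castSucc] <;> fun_prop

theorem contDiff_prolongedBase {K : ℕ} :
    ContDiff ℝ ∞ (prolongedBase : (E × (Fin K → ℝ)) × Input → E × Input) := by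
  refine ContDiff.prodMk (by fun_prop) (contDiff_pi.2 fun c => ?_)
  fin_cases c
  · exact contDiff_prolongedInput 0
  · change ContDiff ℝ ∞ fun q : (E × (Fin K → ℝ)) × Input => q.2 1
    fun_prop

theorem SmoothNear.comp_prolongedBase {F : Type*} [NormedAddCommGroup F] [NormedSpace ℝ F]
    {ψ : E × Input → F} {K : ℕ} {p : Jet E} (hψ : SmoothNear ψ (p.1, p.2 0)) :
    SmoothNear (fun q => ψ (prolongedBase q)) (prolongedProj K p) := by
  refine SmoothNear.comp (g := ψ) (k := prolongedBase) ?_ (contDiff_prolongedBase.smoothNear _)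
  rwa [prolongedBase_proj]

theorem smoothNear_prolong {f : E × Input → E} {K : ℕ} {p : Jet E}
    (hf : SmoothNear f (p.1, p.2 0)) : SmoothNear (prolong f K) (prolongedProj K p) :=
  hf.comp_prolongedBase.prodMk
    (ContDiff.smoothNear (contDiff_pi.2 fun i : Fin K => contDiff_prolongedInput i.succ) _)

theorem prolongedProj_cartanField (f : E × Input → E) (K : ℕ) (p : Jet E) :
    prolongedProj K (cartanField f p) =
      (prolong f K (prolongedProj K p), ![p.2 (K + 1) 0, p.2 1 1]) := by
  refine Prod.ext (Prod.ext ?_ (funext fun i => ?_)) rfl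
  · change f (p.1, p.2 0) = f (prolongedBase (prolongedProj K p))
    rw [prolongedBase_proj]
  · change p.2 (i + 1) 0 = prolongedInput (prolongedProj K p) i.succ
    rw [prolongedInput_proj]
    rfl

/-- The derivatives with respect to the two inputs of the prolonged system are those along `u₁^(K)`
and `u₂`. -/
theorem fderiv_prolonged_input {K N : ℕ} {g : Jet E → ℝ}
    {c : (E × (Fin K → ℝ)) × Input → ℝ} {p : Jet E} (hg : JetSmoothAt N g p)
    (hc : DifferentiableAt ℝ c (prolongedProj K p))
    (hgc : ∀ᶠ q in 𝓝 p, g q = c (prolongedProj K q)) (w : Input) :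
    fderiv ℝ c (prolongedProj K p) (0, w) =
      w 0 * lineDeriv ℝ g p (jetDir K (Pi.single 0 1)) +
        w 1 * lineDeriv ℝ g p (jetDir 0 (Pi.single 1 1)) := by
  have h := lineDeriv_comp_linear (prolongedProj K) (g := c) (p := p) hc (prolongedLift K (0, w))
  rw [prolongedProj_lift] at h
  have h' : lineDeriv ℝ g p (prolongedLift K (0, w)) =
      lineDeriv ℝ (fun q => c (prolongedProj K q)) p (prolongedLift K (0, w)) :=
    lineDeriv_congr_nhds hgc _
  have h'' : lineDeriv ℝ g p (prolongedLift K (0, w)) =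
      w 0 * lineDeriv ℝ g p (jetDir K (Pi.single 0 1)) +
        w 1 * lineDeriv ℝ g p (jetDir 0 (Pi.single 1 1)) := by
    rw [prolongedLift_input, hg.lineDeriv_add, hg.lineDeriv_smul, hg.lineDeriv_smul, smul_eq_mul,
      smul_eq_mul]
  exact h.symm.trans (h'.symm.trans h'')

/-- As long as the time derivatives of `y` do not involve the inputs `u₁^(K)` and `u₂` of the
prolonged system, they are functions on the prolonged system, and are given there by the
derivatives with frozen input. -/
theorem outputDeriv_eq_frozenDeriv {f : E × Input → E} {y : E × Input → ℝ} {p : Jet E}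
    (hf : SmoothNear f (p.1, p.2 0)) (hy : SmoothNear y (p.1, p.2 0)) {K N : ℕ}
    (hfree : ∀ i < N, ∀ᶠ q in 𝓝 p,
      lineDeriv ℝ (outputDeriv f y i) q (jetDir K (Pi.single 0 1)) = 0 ∧
      lineDeriv ℝ (outputDeriv f y i) q (jetDir 0 (Pi.single 1 1)) = 0) (i : ℕ) (hi : i ≤ N) :
    (∀ᶠ q in 𝓝 p, outputDeriv f y i q =
      frozenDeriv (prolong f K) (fun b => y (prolongedBase b)) i (prolongedProj K q)) ∧
    (i < N → ∀ᶠ b in 𝓝 (prolongedProj K p), ∀ w : Input,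
      fderiv ℝ (frozenDeriv (prolong f K) (fun b => y (prolongedBase b)) i) b (0, w) = 0) := by
  have hsm : ∀ i, ∀ᶠ q in 𝓝 p, SmoothNear
      (frozenDeriv (prolong f K) (fun b => y (prolongedBase b)) i) (prolongedProj K q) :=
    fun i => (prolongedProj K).continuous.continuousAt.eventually
      (smoothNear_frozenDeriv (smoothNear_prolong hf) hy.comp_prolongedBase i).eventually
  have hfr : ∀ i < N, (∀ᶠ q in 𝓝 p, outputDeriv f y i q =
      frozenDeriv (prolong f K) (fun b => y (prolongedBase b)) i (prolongedProj K q)) →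
      ∀ᶠ q in 𝓝 p, ∀ w : Input, fderiv ℝ (frozenDeriv (prolong f K)
        (fun b => y (prolongedBase b)) i) (prolongedProj K q) (0, w) = 0 := by
    intro i hi h
    filter_upwards [hsm i, hfree i hi, (jetSmoothAt_outputDeriv hf hy i).eventually,
      eventually_eventually_nhds.2 h] with q h1 h2 h3 h4 w
    rw [fderiv_prolonged_input h3 h1.differentiableAt h4, h2.1, h2.2, mul_zero, mul_zero, add_zero]
  have main : ∀ i ≤ N, ∀ᶠ q in 𝓝 p, outputDeriv f y i q =
      frozenDeriv (prolong f K) (fun b => y (prolongedBase b)) i (prolongedProj K q) := by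
    intro i
    induction i with
    | zero =>
      refine fun _ => Eventually.of_forall fun q => ?_
      rw [outputDeriv_zero, frozenDeriv, prolongedBase_proj]
    | succ i ih =>
      intro hi
      have ih := ih (by omega)
      filter_upwards [hsm i, hfr i hi ih, eventually_eventually_nhds.2 ih] with q h1 h2 h3
      rw [outputDeriv_succ, totalDeriv, lineDeriv_congr_nhds h3,
        lineDeriv_comp_linear _ h1.differentiableAt, prolongedProj_cartanField, frozenDeriv]
      have h5 : ∀ (z : E × (Fin K → ℝ)) (w : Input), (z, w) = (z, 0) + (0, w) := by simp
      rw [h5, map_add, h2, add_zero]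
  exact ⟨main i hi, fun hi' => eventually_of_prolongedProj (hfr i hi' (main i hi))⟩

namespace IsNormalizedAt

variable {f : E × Input → E} {φ : E × Input → Fin 2 → ℝ} {j j' : Fin 2} {k s : ℕ} {p : Jet E}

/-- Every prolongation of length at least `s` has the vector relative degree `(k + K, s)`. -/
theorem hasRelativeDegreeAt (h : IsNormalizedAt f φ j j' k s p) {K : ℕ} (hK : s ≤ K) :
    HasRelativeDegreeAt (prolong f K) (fun q => φ (prolongedBase q))
      (fun l => if l = j then k + K else s) (prolongedProj K p) := by
  have hfirst : ∀ i < k + K, ∀ᶠ q in 𝓝 p,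
      lineDeriv ℝ (outputDeriv f (fun b => φ b j) i) q (jetDir K (Pi.single 0 1)) = 0 ∧
      lineDeriv ℝ (outputDeriv f (fun b => φ b j) i) q (jetDir 0 (Pi.single 1 1)) = 0 := by
    intro i hi
    refine Eventually.and ?_ (h.lineDeriv_snd_input i 0)
    rcases lt_or_ge i k with hik | hik
    · exact (h.input_free i hik).mono fun q hq => hq _
    · obtain ⟨t, rfl⟩ := Nat.exists_eq_add_of_le hik
      filter_upwards [h.lineDeriv_add t] with q hq
      rw [hq, jetDir_snd, if_neg (by omega)]
  have hsecond : ∀ i < s, ∀ᶠ q in 𝓝 p,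
      lineDeriv ℝ (outputDeriv f (fun b => φ b j') i) q (jetDir K (Pi.single 0 1)) = 0 ∧
      lineDeriv ℝ (outputDeriv f (fun b => φ b j') i) q (jetDir 0 (Pi.single 1 1)) = 0 := by
    intro i hi
    filter_upwards [(h.jetSmoothAt j' i).eventually, h.snd_input_free i hi] with q h1 h2
    exact ⟨h1.lineDeriv_jetDir_eq_zero (by omega) _, h2 0⟩
  have hj := outputDeriv_eq_frozenDeriv h.smooth_field (h.smooth_output.apply_output j) hfirst
  have hj' := outputDeriv_eq_frozenDeriv h.smooth_field (h.smooth_output.apply_output j') hsecond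
  have hsm := fun l i => (smoothNear_frozenDeriv (smoothNear_prolong (K := K) h.smooth_field)
    (h.smooth_output.apply_output l).comp_prolongedBase i).differentiableAt
  refine ⟨smoothNear_prolong h.smooth_field, h.smooth_output.comp_prolongedBase,
    fun l i hi => ?_, fun w hw => ?_⟩
  · rcases h.eq_or_eq l with rfl | rfl
    · rw [if_pos rfl] at hi
      exact (hj i hi.le).2 hi
    · rw [if_neg h.ne.symm] at hi
      exact (hj' i hi.le).2 hi
  · have h1 := hw j
    have h2 := hw j'
    simp only [if_pos, if_neg h.ne.symm] at h1 h2
    rw [fderiv_prolonged_input (h.jetSmoothAt j (k + K)) (hsm j _) (hj _ le_rfl).1,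
      (h.lineDeriv_add K).self_of_nhds, (h.lineDeriv_add K).self_of_nhds, jetDir_snd,
      jetDir_snd] at h1
    have hw0 : w 0 = 0 := by simpa using h1
    rw [fderiv_prolonged_input (h.jetSmoothAt j' s) (hsm j' _) (hj' _ le_rfl).1, hw0, zero_mul,
      zero_add] at h2
    have hw1 : w 1 = 0 := (mul_eq_zero.1 h2).resolve_right h.snd_input_ne
    refine funext fun c => ?_
    fin_cases c
    · exact hw0
    · exact hw1

theorem sum_relativeDegree (h : IsNormalizedAt f φ j j' k s p) (K : ℕ) :
    (if (0 : Fin 2) = j then k + K else s) + (if (1 : Fin 2) = j then k + K else s) =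
      k + K + s := by
  have h1 := h.ne
  have h2 : j = 0 ∨ j = 1 := by omega
  rcases h2 with rfl | rfl
  · simp
  · simp [add_comm]

variable [FiniteDimensional ℝ E]

/-- The upper bound is the independence of the differentials in the `s`-fold prolongation, the lower
bound is flatness. -/
theorem add_eq_finrank (h : IsNormalizedAt f φ j j' k s p) {r : ℕ}
    (hflat : IsInfinitesimallyFlatAt f φ r p) : k + s = Module.finrank ℝ E := by
  refine le_antisymm ?_ (h.finrank_le hflat)
  have h1 := (h.hasRelativeDegreeAt le_rfl).sum_le_finrank
  rw [h.sum_relativeDegree, Module.finrank_prod] at h1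
  simp at h1
  omega

/-- Hence the prolongation of the first input as often as the dimension of the state is static
feedback linearizable, with `φ` as a linearizing output. -/
theorem linearizable (h : IsNormalizedAt f φ j j' k s p) {r K : ℕ}
    (hflat : IsInfinitesimallyFlatAt f φ r p) (hK : Module.finrank ℝ E ≤ K) :
    IsStaticFeedbackLinearizableAt (prolong f K) (prolongedProj K p) ∧
      IsLinearizingOutputAt (prolong f K) (fun q => φ (prolongedBase q)) (prolongedProj K p) := by
  have h1 := h.add_eq_finrank hflat
  have h2 := h.hasRelativeDegreeAt (K := K) (by omega)
  have h3 : (if (0 : Fin 2) = j then k + K else s) + (if (1 : Fin 2) = j then k + K else s) =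
      Module.finrank ℝ (E × (Fin K → ℝ)) := by
    rw [h.sum_relativeDegree, Module.finrank_prod]
    simp
    omega
  exact ⟨⟨_, _, _, h2.isBrunovskyTransformationAt h3⟩, h2.isLinearizingOutputAt h3⟩

end IsNormalizedAt

end Prolonged

/-! ### Changes of the input -/

section InputChange

variable {E : Type*} [NormedAddCommGroup E] [NormedSpace ℝ E]

/-- Near `b`, the smooth maps `u ↦ g (x, u)` and `ū ↦ h (x, ū)` are inverse to each other. -/
structure IsInputChangeAt (g h : E × Input → Input) (b : E × Input) : Prop where
  smooth : SmoothNear g b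
  smooth_inv : SmoothNear h (b.1, g b)
  left_inv : ∀ᶠ c in 𝓝 b, h (c.1, g c) = c.2
  right_inv : ∀ᶠ c in 𝓝 (b.1, g b), g (c.1, h c) = c.2

namespace IsInputChangeAt

variable {g h : E × Input → Input} {b : E × Input}

theorem eventually (hgh : IsInputChangeAt g h b) : ∀ᶠ c in 𝓝 b, IsInputChangeAt g h c := by
  have hc : Tendsto (fun c : E × Input => (c.1, g c)) (𝓝 b) (𝓝 (b.1, g b)) :=
    continuousAt_fst.prodMk hgh.smooth.continuousAt
  filter_upwards [hgh.smooth.eventually, hc.eventually hgh.smooth_inv.eventually,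
    eventually_eventually_nhds.2 hgh.left_inv,
    hc.eventually (eventually_eventually_nhds.2 hgh.right_inv)] with c h1 h2 h3 h4
  exact ⟨h1, h2, h3, h4⟩

theorem symm (hgh : IsInputChangeAt g h b) : IsInputChangeAt h g (b.1, g b) := by
  have hb : ((b.1, h (b.1, g b)) : E × Input) = b := Prod.ext rfl hgh.left_inv.self_of_nhds
  refine ⟨hgh.smooth_inv, ?_, hgh.right_inv, ?_⟩
  · exact hb.symm ▸ hgh.smooth
  · exact hb.symm ▸ hgh.left_inv

/-- The partial derivative `∂g/∂u` is injective. -/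
theorem fderiv_injective (hgh : IsInputChangeAt g h b) (w : Input)
    (hw : fderiv ℝ g b (0, w) = 0) : w = 0 := by
  have h1 : HasFDerivAt (fun c : E × Input => (c.1, g c))
      ((ContinuousLinearMap.fst ℝ E Input).prod (fderiv ℝ g b)) b :=
    hasFDerivAt_fst.prodMk hgh.smooth.differentiableAt.hasFDerivAt
  have h2 := HasFDerivAt.comp (g := h) b hgh.smooth_inv.differentiableAt.hasFDerivAt h1
  have h3 : (fun c : E × Input => c.2) =ᶠ[𝓝 b] h ∘ fun c => (c.1, g c) :=
    hgh.left_inv.mono fun c hc => hc.symm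
  have h4 := (h2.congr_of_eventuallyEq h3).unique hasFDerivAt_snd
  have h5 := DFunLike.congr_fun h4 ((0, w) : E × Input)
  have h6 : (fderiv ℝ h (b.1, g b)) (0, fderiv ℝ g b (0, w)) = w := h5
  rw [hw] at h6
  rw [← h6]
  exact map_zero _

end IsInputChangeAt

/-- The inverse function theorem for `(x, u) ↦ (x, g (x, u))`. -/
theorem exists_isInputChangeAt [FiniteDimensional ℝ E] {g : E × Input → Input} {b : E × Input}
    (hg : SmoothNear g b) (hinj : ∀ w : Input, fderiv ℝ g b (0, w) = 0 → w = 0) :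
    ∃ h : E × Input → Input, IsInputChangeAt g h b ∧
      ∀ᶠ c in 𝓝 b, IsInputTransformationAt g h c := by
  have hT : SmoothNear (fun c : E × Input => (c.1, g c)) b := (smoothNear_fst b).prodMk hg
  have hTd : HasFDerivAt (fun c : E × Input => (c.1, g c))
      ((ContinuousLinearMap.fst ℝ E Input).prod (fderiv ℝ g b)) b :=
    hasFDerivAt_fst.prodMk hg.differentiableAt.hasFDerivAt
  obtain ⟨Φ, hbΦ, hΦ⟩ := isLocalDiffeomorphAt_of_injective hT rfl (by
    rw [hTd.fderiv]
    rintro ⟨v, w⟩ hvw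
    have hv : v = 0 := congrArg Prod.fst hvw
    subst hv
    rw [hinj w (congrArg Prod.snd hvw)]
    rfl)
  have hsrc : ∀ᶠ c in 𝓝 b, c ∈ Φ.source := Φ.open_source.mem_nhds hbΦ
  have hΦ' : ∀ c ∈ Φ.source, (c.1, g c) = Φ.toPartialEquiv c := fun c hc => hΦ hc
  have hΦb : (b.1, g b) ∈ Φ.target := by
    rw [hΦ' b hbΦ]
    exact Φ.map_source hbΦ
  have hleft : ∀ᶠ c in 𝓝 b, (Φ.toPartialEquiv.symm (c.1, g c)).2 = c.2 := by
    filter_upwards [hsrc] with c hc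
    rw [hΦ' c hc, Φ.left_inv hc]
  refine ⟨fun c => (Φ.toPartialEquiv.symm c).2, ⟨hg, ?_, hleft, ?_⟩, ?_⟩
  · have h1 : SmoothNear Φ.toPartialEquiv.symm (b.1, g b) :=
      ContDiffOn.smoothNear (contMDiffOn_iff_contDiffOn.1 Φ.contMDiffOn_invFun) Φ.open_target hΦb
    exact SmoothNear.comp (g := fun c : E × Input => c.2) (smoothNear_snd _) h1
  · filter_upwards [Φ.open_target.mem_nhds hΦb] with c hc
    have h1 : (((Φ.toPartialEquiv.symm c).1, g (Φ.toPartialEquiv.symm c)) : E × Input) = c :=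
      (hΦ (Φ.map_target hc)).trans (Φ.right_inv hc)
    have h2 : ((c.1, (Φ.toPartialEquiv.symm c).2) : E × Input) = Φ.toPartialEquiv.symm c :=
      Prod.ext (congrArg Prod.fst h1).symm rfl
    rw [h2]
    exact congrArg Prod.snd h1
  · filter_upwards [hsrc, eventually_eventually_nhds.2 hleft] with c h1 h2
    exact ⟨⟨Φ, h1, hΦ⟩, h2⟩

/-- A function `a` with `∂a/∂u ≠ 0` is the first component of an invertible change of the
input. -/
theorem exists_input_of_fderiv_ne_zero {a : E × Input → ℝ} {b : E × Input} (ha : SmoothNear a b)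
    {w : Input} (hw : fderiv ℝ a b (0, w) ≠ 0) :
    ∃ g : E × Input → Input, (∀ c, g c 0 = a c) ∧ SmoothNear g b ∧
      ∀ w : Input, fderiv ℝ g b (0, w) = 0 → w = 0 := by
  obtain ⟨i, i', hii', hi⟩ : ∃ i i' : Fin 2, i ≠ i' ∧ fderiv ℝ a b (0, Pi.single i 1) ≠ 0 := by
    by_contra! hcon
    refine hw ?_
    have h1 : ((0, w) : E × Input) = w 0 • (0, Pi.single 0 1) + w 1 • (0, Pi.single 1 1) := by
      refine Prod.ext (by simp) (funext fun c => ?_)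
      fin_cases c <;> simp
    rw [h1, map_add, map_smul, map_smul, hcon 0 1 (by decide), hcon 1 0 (by decide)]
    simp
  have hcomp : ∀ c, SmoothNear (fun q : E × Input => (![a q, q.2 i'] : Input) c) b := by
    intro c
    fin_cases c
    · exact ha
    · exact ContDiff.smoothNear (g := fun q : E × Input => q.2 i') (by fun_prop) _
  refine ⟨fun c => ![a c, c.2 i'], fun c => rfl, SmoothNear.pi hcomp, fun w hw0 => ?_⟩
  have h1 := fderiv_pi (𝕜 := ℝ) (φ := fun c (q : E × Input) => (![a q, q.2 i'] : Input) c) (x := b)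
    fun c => (hcomp c).differentiableAt
  have h2 : ∀ c, fderiv ℝ (fun q : E × Input => (![a q, q.2 i'] : Input) c) b (0, w) = 0 := by
    intro c
    have h3 := congrFun hw0 c
    rw [h1] at h3
    exact h3
  have h4 : w i' = 0 := by
    have h5 : HasFDerivAt (fun q : E × Input => q.2 i')
        ((ContinuousLinearMap.proj (R := ℝ) (φ := fun _ : Fin 2 => ℝ) i').comp
          (ContinuousLinearMap.snd ℝ E Input)) b :=
      ((ContinuousLinearMap.proj (R := ℝ) (φ := fun _ : Fin 2 => ℝ) i').comp
          (ContinuousLinearMap.snd ℝ E Input)).hasFDerivAt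
    have h6 := h2 1
    have h7 : fderiv ℝ (fun q : E × Input => q.2 i') b (0, w) = 0 := h6
    rw [h5.fderiv] at h7
    exact h7
  have h8 : ((0, w) : E × Input) = w i • (0, Pi.single i 1) := by
    refine Prod.ext (by simp) (funext fun c => ?_)
    have : c = i ∨ c = i' := by omega
    rcases this with rfl | rfl
    · simp
    · simp [h4, hii'.symm]
  have h9 : fderiv ℝ a b (0, w) = 0 := h2 0
  rw [h8, map_smul, smul_eq_mul] at h9
  have h10 : w i = 0 := (mul_eq_zero.1 h9).resolve_right hi
  refine funext fun c => ?_
  have : c = i ∨ c = i' := by omega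
  rcases this with rfl | rfl
  · exact h10
  · exact h4

/-- If the derivatives of `y` of order less than `k` do not depend on the input, then the derivative
of order `k` is a function of `(x, u)`. -/
theorem exists_outputDeriv_eq_base {f : E × Input → E} {y : E × Input → ℝ} {p : Jet E} {k : ℕ}
    (hf : SmoothNear f (p.1, p.2 0)) (hy : SmoothNear y (p.1, p.2 0))
    (hfree : ∀ i < k, ∀ᶠ q in 𝓝 p, ∀ υ : ℕ → Input,
      lineDeriv ℝ (outputDeriv f y i) q (0, υ) = 0) :
    ∃ a : E × Input → ℝ, SmoothNear a (p.1, p.2 0) ∧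
      ∀ᶠ q in 𝓝 p, outputDeriv f y k q = a (q.1, q.2 0) := by
  -- The `0`-fold prolonged system is the original one, up to the shape of its state.
  have h := (outputDeriv_eq_frozenDeriv hf hy (K := 0) (fun i hi => (hfree i hi).mono
    fun q hq => ⟨hq _, hq _⟩) k le_rfl).1
  have hproj : ∀ q : Jet E, prolongedProj 0 q = ((q.1, (0 : Fin 0 → ℝ)), q.2 0) := by
    intro q
    refine Prod.ext (Prod.ext rfl (Subsingleton.elim _ _)) (funext fun c => ?_)
    fin_cases c <;> rfl
  refine ⟨fun b => frozenDeriv (prolong f 0) (fun b => y (prolongedBase b)) k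
    ((b.1, (0 : Fin 0 → ℝ)), b.2), ?_, ?_⟩
  · have h1 := smoothNear_frozenDeriv (smoothNear_prolong (K := 0) hf) hy.comp_prolongedBase k
    rw [hproj] at h1
    exact SmoothNear.comp (k := fun b : E × Input => ((b.1, (0 : Fin 0 → ℝ)), b.2)) h1
      (ContDiff.smoothNear (by fun_prop) _)
  · filter_upwards [h] with q hq
    rw [hq, hproj]

/-- Inverse changes of the input induce inverse maps of jets. -/
theorem jetMap_jetMap {f f' : E × Input → E} {g h : E × Input → Input} {p : Jet E}
    (hgh : IsInputChangeAt g h (p.1, p.2 0))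
    (hf : SmoothNear f (p.1, p.2 0)) (hf' : SmoothNear f' (p.1, g (p.1, p.2 0)))
    (hff' : ∀ᶠ b in 𝓝 (p.1, p.2 0), f' (b.1, g b) = f b) :
    jetMap f' h (jetMap f g p) = p := by
  refine Prod.ext rfl (funext fun i => ?_)
  have h1 := (outputDeriv_jetMap hf hgh.smooth hf' hff' hgh.smooth_inv i).self_of_nhds
  have h2 := (outputDeriv_congr (f := f) (p := p) hgh.left_inv i).self_of_nhds
  exact h1.trans (h2.trans (outputDeriv_snd f i p))

theorem prolongedPoint_eq {f : E × Input → E} {g : E × Input → Input} {p : Jet E}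
    (hf : SmoothNear f (p.1, p.2 0)) (hg : SmoothNear g (p.1, p.2 0)) (K : ℕ) :
    prolongedPoint f g K p = prolongedProj K (jetMap f g p) := by
  have h := fun i => (outputDeriv_apply hf hg 0 i).self_of_nhds
  rw [prolongedPoint, prolongedProj_apply, h]
  simp only [h]
  rfl

end InputChange

/-! ### Generic jets -/

section Generic

variable {E : Type*} [NormedAddCommGroup E] [NormedSpace ℝ E]

/-- The change of input `ū = g (x, u)` at the jet `p`, together with the smoothness of the system
and of the output there. -/
structure IsJetChangeAt (f : E × Input → E) (φ : E × Input → Fin 2 → ℝ)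
    (g h : E × Input → Input) (p : Jet E) : Prop where
  smooth_field : SmoothNear f (p.1, p.2 0)
  smooth_output : SmoothNear φ (p.1, p.2 0)
  inputChange : IsInputChangeAt g h (p.1, p.2 0)

/-- The output in terms of the new input. -/
def transformOutput (φ : E × Input → Fin 2 → ℝ) (h : E × Input → Input) : E × Input → Fin 2 → ℝ :=
  fun b => φ (b.1, h b)

namespace IsJetChangeAt

variable {f : E × Input → E} {φ : E × Input → Fin 2 → ℝ} {g h : E × Input → Input} {p : Jet E}

theorem eventually (H : IsJetChangeAt f φ g h p) : ∀ᶠ q in 𝓝 p, IsJetChangeAt f φ g h q := by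
  filter_upwards [continuous_jet_base.continuousAt.eventually H.smooth_field.eventually,
    continuous_jet_base.continuousAt.eventually H.smooth_output.eventually,
    continuous_jet_base.continuousAt.eventually H.inputChange.eventually] with q h1 h2 h3
  exact ⟨h1, h2, h3⟩

theorem inv_base (H : IsJetChangeAt f φ g h p) :
    ((p.1, h (p.1, g (p.1, p.2 0))) : E × Input) = (p.1, p.2 0) :=
  Prod.ext rfl H.inputChange.left_inv.self_of_nhds

theorem smooth_field_inv (H : IsJetChangeAt f φ g h p) :
    SmoothNear f (p.1, h (p.1, g (p.1, p.2 0))) := by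
  rw [H.inv_base]
  exact H.smooth_field

theorem smooth_output_inv (H : IsJetChangeAt f φ g h p) :
    SmoothNear φ (p.1, h (p.1, g (p.1, p.2 0))) := by
  rw [H.inv_base]
  exact H.smooth_output

theorem smooth_inv_base (H : IsJetChangeAt f φ g h p) :
    SmoothNear (fun b : E × Input => (b.1, h b)) (p.1, g (p.1, p.2 0)) :=
  (smoothNear_fst _).prodMk H.inputChange.smooth_inv

theorem smooth_transformInput (H : IsJetChangeAt f φ g h p) :
    SmoothNear (transformInput f h) (p.1, g (p.1, p.2 0)) :=
  SmoothNear.comp (g := f) (k := fun b : E × Input => (b.1, h b))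
    H.smooth_field_inv H.smooth_inv_base

theorem smooth_transformOutput (H : IsJetChangeAt f φ g h p) :
    SmoothNear (transformOutput φ h) (p.1, g (p.1, p.2 0)) :=
  SmoothNear.comp (g := φ) (k := fun b : E × Input => (b.1, h b))
    H.smooth_output_inv H.smooth_inv_base

theorem transformInput_eq (H : IsJetChangeAt f φ g h p) :
    ∀ᶠ b in 𝓝 (p.1, p.2 0), transformInput f h (b.1, g b) = f b := by
  filter_upwards [H.inputChange.left_inv] with b hb
  rw [transformInput, hb]

/-- `jetMap (transformInput f h) h` is the inverse of `jetMap f g`. -/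
theorem jetMap_inv (H : IsJetChangeAt f φ g h p) :
    jetMap (transformInput f h) h (jetMap f g p) = p :=
  jetMap_jetMap H.inputChange H.smooth_field H.smooth_transformInput H.transformInput_eq

theorem continuousAt_jetMap (H : IsJetChangeAt f φ g h p) : ContinuousAt (jetMap f g) p :=
  _root_.continuousAt_jetMap H.smooth_field H.inputChange.smooth

theorem tendsto_jetMap_inv (H : IsJetChangeAt f φ g h p) :
    Tendsto (jetMap (transformInput f h) h) (𝓝 (jetMap f g p)) (𝓝 p) := by
  have h1 : ContinuousAt (jetMap (transformInput f h) h) (jetMap f g p) :=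
    _root_.continuousAt_jetMap H.smooth_transformInput H.inputChange.smooth_inv
  rw [ContinuousAt, H.jetMap_inv] at h1
  exact h1

theorem eventually_jetMap_inv_right (H : IsJetChangeAt f φ g h p) :
    ∀ᶠ q in 𝓝 (jetMap f g p), jetMap f g (jetMap (transformInput f h) h q) = q := by
  have hbase : Tendsto (fun q : Jet E => (q.1, q.2 0)) (𝓝 (jetMap f g p))
      (𝓝 (p.1, g (p.1, p.2 0))) := continuous_jet_base.continuousAt
  have hfield : ∀ᶠ b in 𝓝 (p.1, g (p.1, p.2 0)), SmoothNear f (b.1, h b) :=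
    H.smooth_inv_base.continuousAt.eventually H.smooth_field_inv.eventually
  filter_upwards [hbase.eventually H.inputChange.symm.eventually,
    hbase.eventually H.smooth_transformInput.eventually, hbase.eventually hfield] with q h1 h2 h3
  exact jetMap_jetMap h1 h2 h3 (Eventually.of_forall fun _ => rfl)

/-- In the new coordinates, the derivatives of the output are the same functions of jets. -/
theorem outputDeriv_transform (H : IsJetChangeAt f φ g h p) (l : Fin 2) (i : ℕ) :
    ∀ᶠ q in 𝓝 (jetMap f g p),
      outputDeriv (transformInput f h) (fun b => transformOutput φ h b l) i q =
        outputDeriv f (fun b => φ b l) i (jetMap (transformInput f h) h q) := by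
  have := outputDeriv_jetMap (p := jetMap f g p) (f := transformInput f h) (g := h) (f' := f)
    (ψ := fun b => φ b l) H.smooth_transformInput H.inputChange.smooth_inv
    H.smooth_field_inv (Eventually.of_forall fun _ => rfl)
    (H.smooth_output_inv.apply_output l) i
  exact this.mono fun q hq => hq.symm

theorem isInfinitesimallyFlatAt (H : IsJetChangeAt f φ g h p) {r : ℕ}
    (hflat : IsInfinitesimallyFlatAt f φ r p) :
    IsInfinitesimallyFlatAt (transformInput f h) (transformOutput φ h) r (jetMap f g p) :=
  IsInfinitesimallyFlatAt.comp_input (f := f) (f' := transformInput f h) (φ := φ) (h := h)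
    (p := jetMap f g p) (H.jetMap_inv.symm ▸ hflat) H.smooth_transformInput
    H.inputChange.smooth_inv H.smooth_field_inv
    (Eventually.of_forall fun _ => rfl) H.smooth_output_inv
    H.inputChange.symm.fderiv_injective

/-- If the first component of `g` is a derivative of an output of order `k`, and the derivatives of
lower order do not depend on the input, then the same holds in the new coordinates. -/
theorem hasInputOutputAt (H : IsJetChangeAt f φ g h p) {j : Fin 2} {k : ℕ}
    (hk : ∀ᶠ q in 𝓝 p, outputDeriv f (fun b => φ b j) k q = g (q.1, q.2 0) 0)
    (hfree : ∀ i < k, ∀ᶠ q in 𝓝 p, ∀ υ : ℕ → Input,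
      lineDeriv ℝ (outputDeriv f (fun b => φ b j) i) q (0, υ) = 0) :
    HasInputOutputAt (transformInput f h) (transformOutput φ h) j k (jetMap f g p) := by
  have hbase : Tendsto (fun q : Jet E => (q.1, q.2 0)) (𝓝 (jetMap f g p))
      (𝓝 (p.1, g (p.1, p.2 0))) := continuous_jet_base.continuousAt
  refine ⟨H.smooth_transformInput, H.smooth_transformOutput, ?_, fun i hi => ?_⟩
  · filter_upwards [H.outputDeriv_transform j k, H.tendsto_jetMap_inv.eventually hk,
      hbase.eventually H.inputChange.right_inv] with q h1 h2 h3
    rw [h1, h2]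
    exact congrFun h3 0
  · filter_upwards [eventually_eventually_nhds.2 (H.outputDeriv_transform j i),
      H.tendsto_jetMap_inv.eventually (hfree i hi),
      hbase.eventually H.smooth_transformInput.eventually,
      hbase.eventually H.inputChange.smooth_inv.eventually,
      H.tendsto_jetMap_inv.eventually H.eventually] with q h1 h2 h3 h4 h5 υ
    rw [lineDeriv_congr_nhds h1, lineDeriv_comp_jetMap h3 h4
      (jetSmoothAt_outputDeriv h5.smooth_field (h5.smooth_output.apply_output j) i)]
    exact h2 _

end IsJetChangeAt

/-- Infinitesimal flatness forces some derivative of the output to depend on the input. -/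
theorem IsInfinitesimallyFlatAt.exists_input_dependence {f : E × Input → E}
    {φ : E × Input → Fin 2 → ℝ} {r : ℕ} {p : Jet E} (h : IsInfinitesimallyFlatAt f φ r p)
    (c : Fin 2) : ∃ i l, lineDeriv ℝ (outputDeriv f (fun b => φ b l) i) p
      (jetDir 0 (Pi.single c 1)) ≠ 0 := by
  by_contra! hcon
  have h1 := congrFun (h _ fun i _ l => hcon i l).2 c
  rw [jetDir_snd] at h1
  simp at h1

/-- In every nonempty open set of jets there is one near which a derivative of an output can serve as
the first input. -/
theorem exists_hasInputOutputAt [FiniteDimensional ℝ E] {f : E × Input → E}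
    {φ : E × Input → Fin 2 → ℝ}
    {V : Set (Jet E)} (hV : IsOpen V) (hne : V.Nonempty)
    (hf : ∀ p ∈ V, SmoothNear f (p.1, p.2 0)) (hφ : ∀ p ∈ V, SmoothNear φ (p.1, p.2 0))
    (hflat : ∀ p ∈ V, ∃ r, IsInfinitesimallyFlatAt f φ r p) :
    ∃ p ∈ V, ∃ g h j k, IsJetChangeAt f φ g h p ∧
      (∀ᶠ b in 𝓝 (p.1, p.2 0), IsInputTransformationAt g h b) ∧
      HasInputOutputAt (transformInput f h) (transformOutput φ h) j k (jetMap f g p) := by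
  classical
  have hex : ∃ k, ∃ q ∈ V, ∃ l, ∃ υ : ℕ → Input,
      lineDeriv ℝ (outputDeriv f (fun b => φ b l) k) q (0, υ) ≠ 0 := by
    obtain ⟨p, hp⟩ := hne
    obtain ⟨r, hr⟩ := hflat p hp
    obtain ⟨k, l, hkl⟩ := hr.exists_input_dependence 0
    exact ⟨k, p, hp, l, _, hkl⟩
  obtain ⟨p, hp, j, υ, hυ⟩ := Nat.find_spec hex
  -- Minimality over the open set `V` gives the vanishing on a neighbourhood of `p`.
  have hmin : ∀ i < Nat.find hex, ∀ᶠ q in 𝓝 p, ∀ υ : ℕ → Input,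
      lineDeriv ℝ (outputDeriv f (fun b => φ b j) i) q (0, υ) = 0 := by
    intro i hi
    filter_upwards [hV.mem_nhds hp] with q hq υ
    by_contra hne
    exact Nat.find_min hex hi ⟨q, hq, j, υ, hne⟩
  obtain ⟨a, ha, hka⟩ := exists_outputDeriv_eq_base (hf p hp) ((hφ p hp).apply_output j) hmin
  have hbase : JetSmoothAt 1 (fun q : Jet E => (q.1, q.2 0)) p :=
    (JetSmoothAt.fst p).prodMk (JetSmoothAt.snd one_pos p)
  have ha' : fderiv ℝ a (p.1, p.2 0) (0, υ 0) ≠ 0 := by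
    have h1 := JetSmoothAt.lineDeriv_comp (g := fun q : Jet E => (q.1, q.2 0)) ha hbase (0, υ)
    rw [(JetSmoothAt.fst p).lineDeriv_prodMk (JetSmoothAt.snd one_pos p), lineDeriv_jet_fst,
      lineDeriv_jet_snd] at h1
    rw [lineDeriv_congr_nhds hka, h1] at hυ
    exact hυ
  obtain ⟨g, hga, hg, hinj⟩ := exists_input_of_fderiv_ne_zero ha ha'
  obtain ⟨h, hgh, hgh'⟩ := exists_isInputChangeAt hg hinj
  have H : IsJetChangeAt f φ g h p := ⟨hf p hp, hφ p hp, hgh⟩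
  refine ⟨p, hp, g, h, j, Nat.find hex, H, hgh', H.hasInputOutputAt ?_ hmin⟩
  filter_upwards [hka] with q hq
  rw [hq, hga]

/-- Near a jet at which the first new input is a derivative of an output there is a jet at which the
transformed system is in normalized form. -/
theorem exists_isNormalizedAt {f : E × Input → E} {φ : E × Input → Fin 2 → ℝ}
    {g h : E × Input → Input} {j : Fin 2} {k : ℕ} {p : Jet E} (H : IsJetChangeAt f φ g h p)
    (hj : HasInputOutputAt (transformInput f h) (transformOutput φ h) j k (jetMap f g p))
    {r : ℕ} (hflat : IsInfinitesimallyFlatAt f φ r p) {V : Set (Jet E)} (hV : V ∈ 𝓝 p) :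
    ∃ p' ∈ V, IsJetChangeAt f φ g h p' ∧ ∃ j' s,
      IsNormalizedAt (transformInput f h) (transformOutput φ h) j j' k s (jetMap f g p') := by
  classical
  obtain ⟨V₁, hV₁, hV₁o, hpV₁⟩ := eventually_nhds_iff.1
    ((eventually_mem_set.2 hV).and (H.eventually.and (H.continuousAt_jetMap.eventually hj.eventually)))
  obtain ⟨j', hj'⟩ : ∃ j' : Fin 2, j ≠ j' := ⟨1 - j, by omega⟩
  have hex : ∃ s, ∃ q, V₁ q ∧ ∃ m, lineDeriv ℝ (outputDeriv (transformInput f h)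
      (fun b => transformOutput φ h b j') s) (jetMap f g q) (jetDir m (Pi.single 1 1)) ≠ 0 := by
    obtain ⟨s, l, hsl⟩ := (H.isInfinitesimallyFlatAt hflat).exists_input_dependence 1
    have hl : l = j ∨ l = j' := by omega
    rcases hl with rfl | rfl
    · exact absurd (hj.lineDeriv_snd_input s 0).self_of_nhds hsl
    · exact ⟨s, p, hpV₁, 0, hsl⟩
  obtain ⟨q, hq, m, hqm⟩ := Nat.find_spec hex
  obtain ⟨hqV, Hq, hjq⟩ := hV₁ q hq
  -- A jet `q'` near `jetMap f g q` is the image of a jet in `V₁`, to which minimality applies.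
  have hmin : ∀ i < Nat.find hex, ∀ᶠ q' in 𝓝 (jetMap f g q), ∀ m,
      lineDeriv ℝ (outputDeriv (transformInput f h) (fun b => transformOutput φ h b j') i) q'
        (jetDir m (Pi.single 1 1)) = 0 := by
    intro i hi
    filter_upwards [Hq.tendsto_jetMap_inv.eventually (hV₁o.mem_nhds hq),
      Hq.eventually_jetMap_inv_right] with q' h1 h2 m
    by_contra hne
    rw [← h2] at hne
    exact Nat.find_min hex hi ⟨_, h1, m, hne⟩
  refine ⟨q, hqV, Hq, j', Nat.find hex, hjq, hj', hmin, ?_⟩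
  -- The derivative of order `s` involves only `ū₂` itself, not its derivatives.
  rcases Nat.eq_zero_or_pos m with rfl | hm
  · exact hqm
  · have := (lineDeriv_outputDeriv_add hjq.smooth_field (hjq.smooth_output.apply_output j') hmin
      0).self_of_nhds.1 m hm
    exact absurd this hqm

end Generic

end

theorem proposition1 (n : ℕ)
    (Ω : Set ((Fin n → ℝ) × Input)) (hΩ : IsOpen Ω)
    (f : (Fin n → ℝ) × Input → (Fin n → ℝ)) (hf : ContDiffOn ℝ ∞ f Ω)
    (φ : (Fin n → ℝ) × Input → Fin 2 → ℝ)
    (W : Set (Jet (Fin n → ℝ))) (hW : IsOpen W)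
    (hWΩ : ∀ p ∈ W, (p.1, p.2 0) ∈ Ω)
    (hflat : ∀ p ∈ W, IsFlatOutputAt f φ p) :
    ∃ W' ⊆ W, IsOpen W' ∧ W ⊆ closure W' ∧
      ∀ p ∈ W', ∃ g h : (Fin n → ℝ) × Input → Input,
        IsInputTransformationAt g h (p.1, p.2 0) ∧
        IsStaticFeedbackLinearizableAt (prolong (transformInput f h) n)
          (prolongedPoint f g n p) ∧
        IsLinearizingOutputAt (prolong (transformInput f h) n)
          (fun q => φ ((prolongedBase q).1, h (prolongedBase q)))
          (prolongedPoint f g n p) := by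
  have hfs : ∀ p ∈ W, SmoothNear f (p.1, p.2 0) := fun p hp => hf.smoothNear hΩ (hWΩ p hp)
  have hfl : ∀ p ∈ W, ∃ r, IsInfinitesimallyFlatAt f φ r p := fun p hp =>
    (hflat p hp).exists_isInfinitesimallyFlatAt (hfs p hp)
  refine ⟨{p | ∀ᶠ q in 𝓝 p, q ∈ W ∧ ∃ g h : (Fin n → ℝ) × Input → Input,
        IsInputTransformationAt g h (q.1, q.2 0) ∧
        IsStaticFeedbackLinearizableAt (prolong (transformInput f h) n)
          (prolongedPoint f g n q) ∧
        IsLinearizingOutputAt (prolong (transformInput f h) n)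
          (fun q => φ ((prolongedBase q).1, h (prolongedBase q)))
          (prolongedPoint f g n q)},
    fun p hp => hp.self_of_nhds.1, isOpen_setOfPred_eventually_nhds, fun p hp => ?_,
    fun p hp => hp.self_of_nhds.2⟩
  rw [mem_closure_iff]
  intro o ho hpo
  have hV : IsOpen (o ∩ W) := ho.inter hW
  obtain ⟨p₁, hp₁, g, h, j, k, H, hgh, hj⟩ := exists_hasInputOutputAt hV ⟨p, hpo, hp⟩
    (fun q hq => hfs q hq.2) (fun q hq => (hflat q hq.2).1) (fun q hq => hfl q hq.2)
  obtain ⟨r, hr⟩ := hfl p₁ hp₁.2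
  have hgh₁ : ∀ᶠ q in 𝓝 p₁, q ∈ o ∩ W ∧
      ∀ᶠ b in 𝓝 (q.1, q.2 0), IsInputTransformationAt g h b :=
    Eventually.and (hV.mem_nhds hp₁) (continuous_jet_base.continuousAt.eventually
      (eventually_eventually_nhds.2 hgh))
  obtain ⟨p₂, ⟨hp₂, hgh₂⟩, H₂, j', s, hs⟩ := exists_isNormalizedAt H hj hr hgh₁
  refine ⟨p₂, hp₂.1, ?_⟩
  change ∀ᶠ q in 𝓝 p₂, _
  filter_upwards [hW.mem_nhds hp₂.2, H₂.eventually,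
    continuous_jet_base.continuousAt.eventually hgh₂,
    H₂.continuousAt_jetMap.eventually hs.eventually] with q h1 h2 h3 h4
  obtain ⟨r', hr'⟩ := hfl q h1
  have hlin := h4.linearizable (K := n) (h2.isInfinitesimallyFlatAt hr') (by simp)
  rw [← prolongedPoint_eq h2.smooth_field h2.inputChange.smooth] at hlin
  exact ⟨h1, g, h, h3, hlin⟩
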